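/- Let $d\ge 2$ be fixed. A finite regular CW complex is called simplicial if every closed cell has the face poset of a simplex. A $d$-pseudomanifold is a finite simplicial regular CW complex that is pure of dimension $d$ and in which every $(d-1)$-cell belongs to at most two $d$-cells; a $(d-1)$-cell is in the boundary if it belongs to exactly one $d$-cell. A pure $d$-dimensional finite simplicial complex $C$ with $N$ facets is locally constructible (LC) if there is a sequence $T_1,\dots,T_N,\dots,T_k$ ($k\ge N$) of $d$-pseudomanifolds such that $T_1$ is a $d$-simplex; for $i\le N-1$, $T_{i+1}$ is obtained from $T_i$ by gluing a new $d$-simplex to $T_i$ alongside a $(d-1)$-cell in the boundary of $T_i$; for $N\le i<k$, $T_{i+1}$ is obtained from $T_i$ by identifying a pair of distinct $(d-1)$-cells in the boundary of $T_i$ whose intersection contains a $(d-2)$-cell; and $T_k=C$. An LC $d$-sphere (LC $d$-ball) is an LC simplicial complex whose geometric realization is homeomorphic to the $d$-sphere (to the $d$-ball). Then there is an $N_0$, depending only on $d$, such that for every $N\ge N_0$ the number of combinatorial types (isomorphism classes) of LC $d$-spheres with $N$ facets is finite and at most \[ \Big( d\cdot\big(\tfrac{d}{d-1}\big)^{d-1}\cdot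 2^{\frac{2d^2-d}{3}}\Big)^N , \] and it is less than $2^{d^2N}$; and the same two bounds hold for the number of combinatorial types of LC $d$-balls with $N$ facets. -/

import Mathlib

/-- The cell `x` of a face poset (with least element the empty face) is a simplex with `m`
vertices, i.e. of dimension `m - 1`: the interval `[∅, x]` is the Boolean lattice of rank `m`. -/
def IsSimplex {P : Type*} [PartialOrder P] (m : ℕ) (x : P) : Prop :=
  Nonempty (Set.Iic x ≃o Finset (Fin m))

/-- A finite simplicial regular CW complex, given by its face poset, including the empty
face `⊥`. (A regular CW complex is determined up to cellular homeomorphism by its face poset, and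
the posets below are exactly the face posets of the finite regular CW complexes in which every
closed cell has the face poset of a simplex.) -/
structure SimplicialCW : Type 1 where
  Cell : Type
  [order : PartialOrder Cell]
  [bot : OrderBot Cell]
  [finite : Finite Cell]
  simplicial : ∀ x : Cell, ∃ m : ℕ, IsSimplex m x

attribute [instance] SimplicialCW.order SimplicialCW.bot SimplicialCW.finite

namespace SimplicialCW

/-- The set of `d`-cells that contain the cell `σ`. -/
def cofacets (d : ℕ) (P : SimplicialCW) (σ : P.Cell) : Set P.Cell :=
  {t | IsSimplex (d + 1) t ∧ σ ≤ t}

/-- `P` is a `d`-pseudomanifold, possibly with boundary: it is pure of dimension `d`, and each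
`(d-1)`-cell belongs to at most two `d`-cells. -/
def IsPseudomanifold (d : ℕ) (P : SimplicialCW) : Prop :=
  (∀ x : P.Cell, IsMax x → IsSimplex (d + 1) x) ∧
  ∀ σ : P.Cell, IsSimplex d σ → (P.cofacets d σ).ncard ≤ 2

/-- `σ` is a `(d-1)`-cell in the boundary: it belongs to exactly one `d`-cell. -/
def IsBoundaryCell (d : ℕ) (P : SimplicialCW) (σ : P.Cell) : Prop :=
  IsSimplex d σ ∧ (P.cofacets d σ).ncard = 1

/-- `Q` is obtained from `P` by gluing a new `d`-simplex alongside a `(d-1)`-cell `σ` of the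
boundary: `Q` is the union of a copy of `P` and a `d`-simplex `t`, and these two meet
exactly in the closed cell `σ`. -/
def GluesSimplex (d : ℕ) (P Q : SimplicialCW) : Prop :=
  ∃ (j : P.Cell ↪o Q.Cell) (σ : P.Cell) (t : Q.Cell),
    P.IsBoundaryCell d σ ∧ IsSimplex (d + 1) t ∧ IsLowerSet (Set.range j) ∧
    (∀ y : Q.Cell, y ∈ Set.range j ∨ y ≤ t) ∧
    ∀ y : Q.Cell, (y ∈ Set.range j ∧ y ≤ t) ↔ y ≤ j σ

/-- `Q` is obtained from `P` by identifying two distinct `(d-1)`-cells `σ`, `τ` of the boundary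
whose intersection contains a `(d-2)`-cell `F`. The identification is a simplicial isomorphism
`φ` of the closed cell `σ` onto the closed cell `τ` that is the identity on `F` (any other one would
identify two vertices of `τ`, so that the result is not regular), and `Q` is the
quotient complex: its cells are the classes of the equivalence relation generated by `x ∼ φ x`, and
one class is a face of another if this is so for some of their representatives. -/
def IdentifiesCells (d : ℕ) (P Q : SimplicialCW) : Prop :=
  ∃ (σ τ F : P.Cell) (φ : Set.Iic σ ≃o Set.Iic τ) (q : P.Cell → Q.Cell),
    P.IsBoundaryCell d σ ∧ P.IsBoundaryCell d τ ∧ σ ≠ τ ∧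
    IsSimplex (d - 1) F ∧ F ≤ σ ∧ F ≤ τ ∧
    (∀ x : Set.Iic σ, x.1 ≤ F → (φ x).1 = x.1) ∧
    Function.Surjective q ∧
    (∀ x y : P.Cell, q x = q y ↔
      Relation.EqvGen (fun a b : P.Cell => ∃ h : a ≤ σ, (φ ⟨a, h⟩).1 = b) x y) ∧
    ∀ x y : P.Cell, q x ≤ q y ↔ ∃ x' y' : P.Cell, q x' = q x ∧ q y' = q y ∧ x' ≤ y'

end SimplicialCW

namespace AbstractSimplicialComplex

variable {V : Type*}

/-- The facets, i.e. the inclusion-maximal faces. -/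
def facets (K : AbstractSimplicialComplex V) : Set (Finset V) :=
  {s | Maximal (fun t => t ∈ K.faces) s}

/-- `K` is a pure `d`-dimensional complex. -/
def IsPure (d : ℕ) (K : AbstractSimplicialComplex V) : Prop :=
  K.faces.Nonempty ∧ ∀ s ∈ K.facets, s.card = d + 1

/-- `K` is locally constructible: with `N` the number of facets of `K`, there is a sequence
`T 1, …, T N, …, T k` of `d`-pseudomanifolds which starts with a `d`-simplex, attaches new
`d`-simplices along boundary `(d-1)`-cells up to `T N`, then identifies pairs of adjacent boundary
`(d-1)`-cells, and arrives at `K`. (The values `T i` with `i = 0` or `i > k` play no role.) -/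
def IsLC (d : ℕ) (K : AbstractSimplicialComplex V) : Prop :=
  K.IsPure d ∧
  ∃ (k : ℕ) (T : ℕ → SimplicialCW),
    K.facets.ncard ≤ k ∧
    (∀ i, 1 ≤ i → i ≤ k → (T i).IsPseudomanifold d) ∧
    Nonempty ((T 1).Cell ≃o Finset (Fin (d + 1))) ∧
    (∀ i, 1 ≤ i → i < K.facets.ncard → (T i).GluesSimplex d (T (i + 1))) ∧
    (∀ i, K.facets.ncard ≤ i → i < k → (T i).IdentifiesCells d (T (i + 1))) ∧
    Nonempty ((T k).Cell ≃o WithBot {s : Finset V // s ∈ K.faces})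

/-- The geometric realization of a finite complex, in barycentric coordinates. -/
def realization [Fintype V] (K : AbstractSimplicialComplex V) : Set (V → ℝ) :=
  {x | x ∈ stdSimplex ℝ V ∧ ∃ s ∈ K.faces, ∀ v, v ∉ s → x v = 0}

/-- `K` triangulates the `d`-sphere. -/
def IsSphere [Fintype V] (d : ℕ) (K : AbstractSimplicialComplex V) : Prop :=
  Nonempty (K.realization ≃ₜ Metric.sphere (0 : EuclideanSpace ℝ (Fin (d + 1))) 1)

/-- `K` triangulates the `d`-ball. -/
def IsBall [Fintype V] (d : ℕ) (K : AbstractSimplicialComplex V) : Prop :=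
  Nonempty (K.realization ≃ₜ Metric.closedBall (0 : EuclideanSpace ℝ (Fin d)) 1)

end AbstractSimplicialComplex

/-- Finite simplicial complexes, with vertex set `{0, …, n-1}` for some `n`. -/
abbrev FiniteComplex : Type := Σ n : ℕ, AbstractSimplicialComplex (Fin n)

/-- Combinatorial equivalence: a bijection of the vertex sets that preserves faces both ways. -/
def combinatorialEquivalence : Setoid FiniteComplex where
  r K L := ∃ e : Fin K.1 ≃ Fin L.1,
    ∀ s : Finset (Fin K.1), s ∈ K.2.faces ↔ s.map e.toEmbedding ∈ L.2.faces
  iseqv :=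
    { refl := fun K => ⟨Equiv.refl _, fun s => by simp⟩
      symm := by
        rintro K L ⟨e, he⟩
        refine ⟨e.symm, fun s => ?_⟩
        rw [he, Finset.map_map]
        simp
      trans := by
        rintro K L M ⟨e, he⟩ ⟨f, hf⟩
        refine ⟨e.trans f, fun s => ?_⟩
        rw [he, hf, Finset.map_map]
        rfl }

/-- The combinatorial types of finite complexes that have a representative with property `p`. -/
def combinatorialTypes (p : FiniteComplex → Prop) : Set (Quotient combinatorialEquivalence) :=
  {c | ∃ K : FiniteComplex, p K ∧ Quotient.mk combinatorialEquivalence K = c}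

/-- The combinatorial types of LC `d`-spheres with `N` facets. -/
def lcSphereTypes (d N : ℕ) : Set (Quotient combinatorialEquivalence) :=
  combinatorialTypes fun K => K.2.IsSphere d ∧ K.2.IsLC d ∧ K.2.facets.ncard = N

/-- The combinatorial types of LC `d`-balls with `N` facets. -/
def lcBallTypes (d N : ℕ) : Set (Quotient combinatorialEquivalence) :=
  combinatorialTypes fun K => K.2.IsBall d ∧ K.2.IsLC d ∧ K.2.facets.ncard = N

/-!
The bound holds for all locally constructible complexes, whatever their topology: such a complex is
determined by two words of zeros and ones, which steer its reconstruction.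

Let `K` be locally constructible with `N` facets. Its interior `(d-1)`-faces ("doors") are of two kinds:
the `N - 1` doors along which the simplices have been attached, which form a spanning tree of the dual
graph, and those that come from identifications. When two boundary cells are identified, they share a
`(d-2)`-cell `F`, and the `d`-cells at these two cells are already connected around `F` through doors
that have been opened before. So the definition through CW complexes amounts to a
condition on the family of facets of `K` alone (`FacetFamily.IsConstructible`): every set of doors that
contains the tree, and with it each door whose two facets it connects around a
codimension-one face of this door, contains all doors. This condition is carried along the sequence of
CW complexes in `SimplicialCW.IsConstructible.gluesSimplex` and
`SimplicialCW.IsConstructible.identifiesCells`, together with the connectedness of the stars of all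
cells.

To encode the tree, one asks for each side of each simplex (other than the side where it has been
attached) whether a new simplex is attached there. These are `dN + 1` questions with `N - 1` positive
answers. The labels of the vertices of one simplex propagate along the tree. To encode the
identifications, one lets a queue of `(d-2)`-faces run. For each of them, the walk around it through
open doors ends at two free sides (`FacetFamily.IsConstructible.eq_of_closed_side`), and one asks
whether these form a door of `K`. A positive answer opens this door and prolongs the walks
around its other `d - 1` faces, which join the queue. The order of the original identifications
plays no role, and at the end of the queue all doors are open
(`FacetFamily.IsConstructible.glueInv_step`, `FacetFamily.IsConstructible.eq_gluing_of_glueInv`).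
As the stars of the vertices are connected, the opened doors account for all coincidences of vertices,
so that the result determines `K` (`FacetFamily.IsConstructible.exists_equiv`).

A tree with `N` simplices has `X = (d - 1) N + 2` free sides, so that there are at most
`d X + (d - 1) X / 2` questions of the second kind, at most `X / 2` of them with a positive answer. The
number of words with at most `n` ones among `L` letters is at most `x ^ n ((x + 1) / x) ^ L`
(`QueueProcess.card_codes_le`). For `x = d - 1` this gives the factor `(d (d / (d - 1)) ^ (d - 1)) ^ N`
for the trees. For the identifications, `x = 3 d - 2` gives a growth rate that is strictly below
`2 ^ ((2 d² - d) / 3)` (`LCEstimate.gluing_rate_lt`), and this margin absorbs all constant factors.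
-/

/-! ### Queue processes and their codes -/

namespace QueueProcess

variable {σ α : Type*}

/-- Runs a queue process. A state `s` comes with a queue of questions. The bits answer the questions
in order: a question answered by `false` is dropped, while one answered by `true` changes the state
and appends new questions to the queue, both as prescribed by `f`. -/
def run (f : σ → α → σ × List α) : σ → List α → List Bool → σ
  | s, [], _ => s
  | s, _ :: _, [] => s
  | s, _ :: q, false :: bs => run f s q bs
  | s, x :: q, true :: bs => run f (f s x).1 (q ++ (f s x).2) bs

/-- The words of length `L` with at most `n` letters `true`. -/
def codes : ℕ → ℕ → Finset (List Bool)
  | 0, _ => {[]}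
  | L + 1, 0 => (codes L 0).image (List.cons false)
  | L + 1, n + 1 => (codes L (n + 1)).image (List.cons false) ∪ (codes L n).image (List.cons true)

theorem false_cons_mem_codes {L n : ℕ} {bs : List Bool} (h : bs ∈ codes L n) :
    false :: bs ∈ codes (L + 1) n := by
  cases n <;> simp [codes, h]

theorem true_cons_mem_codes {L n : ℕ} {bs : List Bool} (h : bs ∈ codes L n) :
    true :: bs ∈ codes (L + 1) (n + 1) := by
  simp [codes, h]

theorem codes_nonempty (L n : ℕ) : (codes L n).Nonempty := by
  induction L with
  | zero => exact ⟨[], by simp [codes]⟩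
  | succ L ih => exact ⟨_, false_cons_mem_codes ih.choose_spec⟩

/-- If a queue process can be steered so that `Inv` is kept, with at most `n` answers `true`, each of
which adds at most `k` questions, then some code leads to an empty queue. -/
theorem exists_code (f : σ → α → σ × List α) (k : ℕ) (Inv : ℕ → σ → List α → Prop)
    (hInv : ∀ n s x q, Inv n s (x :: q) → Inv n s q ∨
      ∃ n', n = n' + 1 ∧ (f s x).2.length ≤ k ∧ Inv n' (f s x).1 (q ++ (f s x).2)) :
    ∀ (L n : ℕ) (s : σ) (q : List α), q.length + k * n ≤ L → Inv n s q →
      ∃ bs ∈ codes L n, ∃ n', Inv n' (run f s q bs) [] := by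
  intro L
  induction L with
  | zero =>
    intro n s q hL h
    obtain rfl : q = [] := List.length_eq_zero_iff.1 (by omega)
    exact ⟨[], by simp [codes], n, by simpa [run] using h⟩
  | succ L ih =>
    intro n s q hL h
    cases q with
    | nil =>
      obtain ⟨bs, hbs⟩ := codes_nonempty (L + 1) n
      exact ⟨bs, hbs, n, by simpa [run] using h⟩
    | cons x q =>
      rcases hInv n s x q h with h | ⟨n', rfl, hk, h⟩
      · obtain ⟨bs, hbs, n', h'⟩ := ih n s q (by simp at hL; omega) h
        exact ⟨false :: bs, false_cons_mem_codes hbs, n', by simpa [run] using h'⟩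
      · obtain ⟨bs, hbs, n'', h'⟩ := ih n' _ _ (by
          simp only [List.length_cons, List.length_append, mul_add] at hL ⊢; omega) h
        exact ⟨true :: bs, true_cons_mem_codes hbs, n'', by simpa [run] using h'⟩

/-- The number of codes is bounded by the reciprocal of the least probability of such a word, when
its letters are independent and equal to `true` with probability `1 / (x + 1)`. -/
theorem card_codes_le (x : ℝ) (hx : 1 ≤ x) (L n : ℕ) :
    ((codes L n).card : ℝ) ≤ x ^ n * ((x + 1) / x) ^ L := by
  have hr : 1 ≤ (x + 1) / x := by rw [le_div_iff₀ (by linarith)]; linarith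
  induction L generalizing n with
  | zero => simpa [codes] using one_le_pow₀ hx
  | succ L ih =>
    cases n with
    | zero =>
      have h1 : ((codes (L + 1) 0).card : ℝ) ≤ (codes L 0).card := by
        exact_mod_cast Finset.card_image_le
      refine h1.trans ((ih 0).trans ?_)
      simpa using pow_le_pow_right₀ hr (Nat.le_succ L)
    | succ n =>
      have h1 : ((codes (L + 1) (n + 1)).card : ℝ) ≤
          (codes L (n + 1)).card + (codes L n).card := by
        refine le_trans (Nat.cast_le.2 (Finset.card_union_le _ _)) ?_
        push_cast
        exact add_le_add (Nat.cast_le.2 Finset.card_image_le) (Nat.cast_le.2 Finset.card_image_le)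
      refine h1.trans ((add_le_add (ih (n + 1)) (ih n)).trans (le_of_eq ?_))
      have : x ≠ 0 := by linarith
      rw [pow_succ _ L, pow_succ x n]
      field_simp

end QueueProcess

/-! ### Estimates -/

namespace LCEstimate

theorem one_add_inv_pow_le_exp (k : ℕ) (hk : k ≠ 0) : (((k : ℝ) + 1) / k) ^ k ≤ Real.exp 1 := by
  have hk' : (k : ℝ) ≠ 0 := by exact_mod_cast hk
  have h1 : ((k : ℝ) + 1) / k ≤ Real.exp (1 / k) := by
    have := Real.add_one_le_exp (1 / (k : ℝ))
    rw [add_div, div_self hk']; linarith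
  calc (((k : ℝ) + 1) / k) ^ k ≤ Real.exp (1 / k) ^ k := by gcongr
    _ = Real.exp 1 := by rw [← Real.exp_nat_mul]; congr 1; field_simp

/-- With `d = e + 2` and `q = 3 d - 1`, the growth rate of the codes of the gluings, raised to a power
that makes the exponents integers. -/
theorem gluing_rate_lt (e : ℕ) :
    (((3 * e + 4 : ℕ) : ℝ) * ((((3 * e + 4 : ℕ) : ℝ) + 1) / ((3 * e + 4 : ℕ) : ℝ)) ^ (3 * e + 5))
      ^ (3 * (e + 1)) < 2 ^ (2 * (2 * (e + 2) ^ 2 - (e + 2))) := by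
  have hsub : 2 * (2 * (e + 2) ^ 2 - (e + 2)) = 2 * (e + 2) * (2 * e + 3) := by
    have : 2 * (e + 2) ^ 2 = (e + 2) * (2 * e + 3) + (e + 2) := by ring
    rw [this, Nat.add_sub_cancel]; ring
  rw [hsub]
  set y := ((3 * e + 4 : ℕ) : ℝ) * ((((3 * e + 4 : ℕ) : ℝ) + 1) / ((3 * e + 4 : ℕ) : ℝ)) ^ (3 * e + 5)
    with hy
  have hy0 : 0 ≤ y := by positivity
  have hye : y ≤ (3 * e + 5) * 2.7182818286 := by
    have h := one_add_inv_pow_le_exp (3 * e + 4) (by omega)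
    have h2 := Real.exp_one_lt_d9
    have : y = (3 * e + 5) * ((((3 * e + 4 : ℕ) : ℝ) + 1) / ((3 * e + 4 : ℕ) : ℝ)) ^ (3 * e + 4) := by
      rw [hy, pow_succ]
      have : ((3 * e + 4 : ℕ) : ℝ) ≠ 0 := by positivity
      field_simp
      push_cast; ring
    rw [this]
    have : (0:ℝ) ≤ 3 * e + 5 := by positivity
    exact mul_le_mul_of_nonneg_left (h.trans h2.le) this
  -- The bound by Euler's number is good enough for `d ≥ 3`, while `d = 2` needs the exact value of `y`.
  have hcube : ∀ e : ℕ, (((3 : ℝ) * (e + 1 : ℕ) + 5) * 2.7182818286) ^ 3 ≤ 2 ^ (4 * (e + 1) + 10) := by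
    intro e
    induction e with
    | zero => norm_num
    | succ e ih =>
      have h1 : ((3 : ℝ) * (e + 1 + 1 : ℕ) + 5) * 2.7182818286 ≤
          2 * (((3 : ℝ) * (e + 1 : ℕ) + 5) * 2.7182818286) := by
        push_cast; nlinarith [(Nat.cast_nonneg e : (0:ℝ) ≤ e)]
      calc (((3 : ℝ) * (e + 1 + 1 : ℕ) + 5) * 2.7182818286) ^ 3
          ≤ (2 * (((3 : ℝ) * (e + 1 : ℕ) + 5) * 2.7182818286)) ^ 3 := by gcongr
        _ = 8 * (((3 : ℝ) * (e + 1 : ℕ) + 5) * 2.7182818286) ^ 3 := by ring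
        _ ≤ 16 * 2 ^ (4 * (e + 1) + 10) := by
            apply mul_le_mul (by norm_num) ih (by positivity) (by norm_num)
        _ = 2 ^ (4 * (e + 1 + 1) + 10) := by ring
  rcases e with _ | e
  · have h : y ≤ 14 := by rw [hy]; norm_num
    calc y ^ (3 * (0 + 1)) ≤ 14 ^ (3 * (0 + 1)) := by gcongr
      _ < _ := by norm_num
  · have h3 : y ^ 3 ≤ 2 ^ (4 * (e + 1) + 10) := by
      refine le_trans ?_ (hcube e)
      gcongr
    calc y ^ (3 * (e + 1 + 1)) = (y ^ 3) ^ (e + 1 + 1) := by rw [pow_mul]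
      _ ≤ (2 ^ (4 * (e + 1) + 10)) ^ (e + 1 + 1) := by gcongr
      _ = 2 ^ ((4 * (e + 1) + 10) * (e + 1 + 1)) := by rw [pow_mul]
      _ < 2 ^ (2 * (e + 1 + 2) * (2 * (e + 1) + 3)) := by
        apply pow_lt_pow_right₀ (by norm_num)
        nlinarith

/-- With `d = e + 2`, the growth rate of the trees. -/
theorem tree_rate_le (e : ℕ) :
    (((e + 2 : ℕ) : ℝ) * (((e + 2 : ℕ) : ℝ) / (e + 1 : ℕ)) ^ (e + 1)) ^ 3 ≤
      2 ^ ((e + 2) ^ 2 + (e + 2)) := by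
  rcases e with _ | e
  · norm_num
  · set a := (((e + 1 + 2 : ℕ) : ℝ) * (((e + 1 + 2 : ℕ) : ℝ) / (e + 1 + 1 : ℕ)) ^ (e + 1 + 1)) with ha
    have h1 : a ≤ (e + 3) * 2.7182818286 := by
      have h := (one_add_inv_pow_le_exp (e + 2) (by omega)).trans Real.exp_one_lt_d9.le
      have : a = (e + 3) * ((((e + 2 : ℕ) : ℝ) + 1) / (e + 2 : ℕ)) ^ (e + 2) := by
        rw [ha]; push_cast; ring_nf
      rw [this]
      exact mul_le_mul_of_nonneg_left h (by positivity)
    have h2 : ∀ e : ℕ, (((e : ℝ) + 3) * 2.7182818286) ^ 3 ≤ 2 ^ ((e + 3) ^ 2 + (e + 3)) := by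
      intro e
      induction e with
      | zero => norm_num
      | succ e ih =>
        have h1 : (((e + 1 : ℕ) : ℝ) + 3) * 2.7182818286 ≤ 2 * (((e : ℝ) + 3) * 2.7182818286) := by
          push_cast; nlinarith [(Nat.cast_nonneg e : (0:ℝ) ≤ e)]
        calc ((((e + 1 : ℕ) : ℝ) + 3) * 2.7182818286) ^ 3
            ≤ (2 * (((e : ℝ) + 3) * 2.7182818286)) ^ 3 := by gcongr
          _ = 2 ^ 3 * (((e : ℝ) + 3) * 2.7182818286) ^ 3 := by ring
          _ ≤ 2 ^ 3 * 2 ^ ((e + 3) ^ 2 + (e + 3)) := by gcongr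
          _ = 2 ^ (3 + ((e + 3) ^ 2 + (e + 3))) := by rw [pow_add 2 3]
          _ ≤ 2 ^ ((e + 1 + 3) ^ 2 + (e + 1 + 3)) := by
            apply pow_le_pow_right₀ (by norm_num); nlinarith
    calc a ^ 3 ≤ ((e + 3) * 2.7182818286) ^ 3 := by gcongr
      _ ≤ _ := h2 e

/-- The growth rate of the theorem. -/
noncomputable def rate (d : ℕ) : ℝ :=
  (d : ℝ) * ((d : ℝ) / ((d : ℝ) - 1)) ^ (d - 1) * (2 : ℝ) ^ ((2 * (d : ℝ) ^ 2 - (d : ℝ)) / 3)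

theorem two_rpow_cube (e : ℕ) :
    ((2 : ℝ) ^ ((2 * ((e + 2 : ℕ) : ℝ) ^ 2 - ((e + 2 : ℕ) : ℝ)) / 3)) ^ 3 =
      2 ^ (2 * (e + 2) ^ 2 - (e + 2)) := by
  rw [← Real.rpow_natCast _ 3, ← Real.rpow_mul (by norm_num),
    ← Real.rpow_natCast 2 (2 * (e + 2) ^ 2 - (e + 2))]
  rw [Nat.cast_sub (by nlinarith)]
  congr 1
  push_cast; ring

theorem rate_nonneg (d : ℕ) (hd : 2 ≤ d) : 0 ≤ rate d := by
  have h : (2 : ℝ) ≤ d := by exact_mod_cast hd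
  have : (0 : ℝ) ≤ (d : ℝ) - 1 := by linarith
  unfold rate
  positivity

theorem rate_le (d : ℕ) (hd : 2 ≤ d) : rate d ≤ 2 ^ (d ^ 2) := by
  obtain ⟨e, rfl⟩ := Nat.exists_eq_add_of_le' hd
  have h3 : rate (e + 2) ^ 3 ≤ (2 ^ ((e + 2) ^ 2)) ^ 3 := by
    unfold rate
    rw [mul_pow, two_rpow_cube]
    have h1 := tree_rate_le e
    have h2 : ((e + 2 : ℕ) : ℝ) - 1 = (e + 1 : ℕ) := by push_cast; ring
    rw [h2, show e + 2 - 1 = e + 1 from rfl]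
    calc _ ≤ (2:ℝ) ^ ((e + 2) ^ 2 + (e + 2)) * 2 ^ (2 * (e + 2) ^ 2 - (e + 2)) := by gcongr
      _ = (2 ^ ((e + 2) ^ 2)) ^ 3 := by
        rw [← pow_add, ← pow_mul]
        congr 1
        have : e + 2 ≤ 2 * (e + 2) ^ 2 := by nlinarith
        omega
  exact le_of_pow_le_pow_left₀ (by norm_num) (by positivity) h3

/-- The number of pairs of codes, one for a tree of `N` simplices and one for the identifications of
boundary cells, is eventually less than the `N`-th power of the rate. -/
theorem eventually_codes_lt (d : ℕ) (hd : 2 ≤ d) : ∃ N₀ : ℕ, 1 ≤ N₀ ∧ ∀ N, N₀ ≤ N →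
    (((QueueProcess.codes (d * N + 1) (N - 1)).card * (QueueProcess.codes
      (d * ((d - 1) * N + 2) + (d - 1) * (((d - 1) * N + 2) / 2))
      (((d - 1) * N + 2) / 2)).card : ℕ) : ℝ)
      < rate d ^ N := by
  obtain ⟨e, rfl⟩ := Nat.exists_eq_add_of_le' hd
  rw [show e + 2 - 1 = e + 1 from rfl]
  set y := ((3 * e + 4 : ℕ) : ℝ) * ((((3 * e + 4 : ℕ) : ℝ) + 1) / ((3 * e + 4 : ℕ) : ℝ)) ^ (3 * e + 5)
    with hy
  set b := (2 : ℝ) ^ ((2 * ((e + 2 : ℕ) : ℝ) ^ 2 - ((e + 2 : ℕ) : ℝ)) / 3) with hb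
  set a := ((e + 2 : ℕ) : ℝ) * (((e + 2 : ℕ) : ℝ) / (e + 1 : ℕ)) ^ (e + 1) with ha
  have hrate : rate (e + 2) = a * b := by
    have h2 : ((e + 2 : ℕ) : ℝ) - 1 = (e + 1 : ℕ) := by push_cast; ring
    rw [rate, h2, ha, hb]; rfl
  have hy0 : 0 < y := by positivity
  have hb0 : 0 < b := by positivity
  have ha0 : 0 < a := by positivity
  have hlt : y ^ (e + 1) < b ^ 2 := by
    refine lt_of_pow_lt_pow_left₀ 3 (by positivity) ?_
    rw [← pow_mul, ← pow_mul, mul_comm 2 3, pow_mul b, two_rpow_cube, ← pow_mul, mul_comm _ 2,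
      mul_comm _ 3]
    exact gluing_rate_lt e
  obtain ⟨N₁, hN₁⟩ : ∃ N₁ : ℕ, ∀ N ≥ N₁, 4 * y ^ 2 * (y ^ (e + 1)) ^ N < (b ^ 2) ^ N := by
    have hr : y ^ (e + 1) / b ^ 2 < 1 := (div_lt_one (by positivity)).2 hlt
    have ht := tendsto_pow_atTop_nhds_zero_of_lt_one (by positivity) hr
    have hev := ht.eventually (gt_mem_nhds (show 0 < 1 / (4 * y ^ 2) by positivity))
    obtain ⟨N₁, h⟩ := Filter.eventually_atTop.1 hev
    refine ⟨N₁, fun N hN => ?_⟩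
    have := h N hN
    rw [div_pow, div_lt_div_iff₀ (by positivity) (by positivity)] at this
    linarith
  refine ⟨max 1 N₁, le_max_left _ _, fun N hN => ?_⟩
  have hN1 : 1 ≤ N := (le_max_left _ _).trans hN
  have hN2 := hN₁ N ((le_max_right _ _).trans hN)
  set X := (e + 1) * N + 2 with hX
  set n := X / 2 with hn
  have hnX : 2 * n ≤ X := Nat.mul_div_le X 2
  have hM1 : ((QueueProcess.codes ((e + 2) * N + 1) (N - 1)).card : ℝ) ≤ 2 * a ^ N := by
    refine (QueueProcess.card_codes_le ((e + 1 : ℕ) : ℝ) (Nat.one_le_cast.2 (by omega)) _ _).trans ?_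
    obtain ⟨M, rfl⟩ := Nat.exists_eq_add_of_le' hN1
    have h1 : ((e + 1 : ℕ) : ℝ) + 1 = ((e + 2 : ℕ) : ℝ) := by push_cast; ring
    have he : ((e + 1 : ℕ) : ℝ) ≠ 0 := by positivity
    rw [h1, Nat.add_sub_cancel]
    have h2 : a = ((e + 1 : ℕ) : ℝ) * (((e + 2 : ℕ) : ℝ) / (e + 1 : ℕ)) ^ (e + 2) := by
      rw [ha, pow_succ _ (e + 1)]; field_simp
    have h3 : (((e + 2 : ℕ) : ℝ) / (e + 1 : ℕ)) ≤ 2 * (e + 1 : ℕ) := by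
      rw [div_le_iff₀ (by positivity)]; push_cast; nlinarith [(Nat.cast_nonneg e : (0:ℝ) ≤ e)]
    rw [h2, mul_pow, ← pow_mul, pow_succ ((e + 1 : ℕ) : ℝ) M, pow_succ _ ((e + 2) * (M + 1))]
    have h4 : 0 ≤ ((e + 1 : ℕ) : ℝ) ^ M * (((e + 2 : ℕ) : ℝ) / (e + 1 : ℕ)) ^ ((e + 2) * (M + 1)) := by
      positivity
    nlinarith [mul_le_mul_of_nonneg_left h3 h4]
  set M2 := ((QueueProcess.codes ((e + 2) * X + (e + 1) * n) n).card : ℝ) with hM2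
  have hM2le : M2 ^ 2 ≤ y ^ X := by
    have h1 := QueueProcess.card_codes_le ((3 * e + 4 : ℕ) : ℝ) (Nat.one_le_cast.2 (by omega))
      ((e + 2) * X + (e + 1) * n) n
    set x := ((3 * e + 4 : ℕ) : ℝ) with hx
    have hx1 : 1 ≤ x := by rw [hx]; push_cast; linarith [(Nat.cast_nonneg e : (0:ℝ) ≤ e)]
    have hr : 1 ≤ (x + 1) / x := by rw [le_div_iff₀ (by linarith)]; linarith
    calc M2 ^ 2 ≤ (x ^ n * ((x + 1) / x) ^ ((e + 2) * X + (e + 1) * n)) ^ 2 := by gcongr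
      _ = x ^ (2 * n) * ((x + 1) / x) ^ (2 * ((e + 2) * X) + (e + 1) * (2 * n)) := by
        rw [mul_pow, ← pow_mul, ← pow_mul]; congr 2 <;> ring_nf
      _ ≤ x ^ X * ((x + 1) / x) ^ (2 * ((e + 2) * X) + (e + 1) * X) := by
        gcongr
      _ = y ^ X := by rw [hy, mul_pow, ← pow_mul]; congr 2; ring
  have hM20 : 0 ≤ M2 := Nat.cast_nonneg _
  have h2M2 : 2 * M2 < b ^ N := by
    refine lt_of_pow_lt_pow_left₀ 2 (by positivity) ?_
    calc (2 * M2) ^ 2 = 4 * M2 ^ 2 := by ring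
      _ ≤ 4 * y ^ X := by gcongr
      _ = 4 * y ^ 2 * (y ^ (e + 1)) ^ N := by rw [hX, pow_add, pow_mul]; ring
      _ < (b ^ 2) ^ N := hN2
      _ = (b ^ N) ^ 2 := by rw [← pow_mul, ← pow_mul, mul_comm]
  push_cast
  rw [hrate, mul_pow]
  calc _ ≤ 2 * a ^ N * M2 := by gcongr
    _ = a ^ N * (2 * M2) := by ring
    _ < a ^ N * b ^ N := by gcongr

end LCEstimate

/-! ### Walks around codimension-two faces -/

namespace FacetFamily

open Relation

variable {V : Type*}

/-- The facets `a` and `b` are adjacent through a `(d-1)`-face that belongs to `A` and contains `F`.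
(Faces are sets of vertices, so that a `(d-1)`-face has `d` elements.) -/
def Cross (d : ℕ) (𝓕 : Finset (Finset V)) (A : Set (Finset V)) (F a b : Finset V) : Prop :=
  a ∈ 𝓕 ∧ b ∈ 𝓕 ∧ a ≠ b ∧ ∃ m ∈ A, m.card = d ∧ F ⊆ m ∧ m ⊆ a ∧ m ⊆ b

/-- `m` is an interior `(d-1)`-face between the facets `s` and `t`. -/
def IsDoor (d : ℕ) (𝓕 : Finset (Finset V)) (m s t : Finset V) : Prop :=
  m.card = d ∧ s ∈ 𝓕 ∧ t ∈ 𝓕 ∧ s ≠ t ∧ m ⊆ s ∧ m ⊆ t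

/-- What is needed to know about the family `𝓕` of facets of a locally constructible complex: `E` is
the set of `(d-1)`-faces along which the simplices are attached to each other, and all other interior
`(d-1)`-faces are obtained from `E` by successive identifications of adjacent cells: such a
face joins two facets that are already connected around one of its codimension-one faces. -/
structure IsConstructible (d : ℕ) (𝓕 E : Finset (Finset V)) : Prop where
  card_facet : ∀ f ∈ 𝓕, f.card = d + 1
  eq_of_three : ∀ m a b c, m.card = d → a ∈ 𝓕 → b ∈ 𝓕 → c ∈ 𝓕 → m ⊆ a → m ⊆ b → m ⊆ c →
    b ≠ a → c ≠ a → b = c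
  star : ∀ v, ∀ s ∈ 𝓕, ∀ t ∈ 𝓕, v ∈ s → v ∈ t →
    ReflTransGen (Cross d 𝓕 Set.univ {v}) s t
  connected : ∀ s ∈ 𝓕, ∀ t ∈ 𝓕, ReflTransGen (Cross d 𝓕 E ∅) s t
  card_tree : E.card + 1 ≤ 𝓕.card
  closure : ∀ A : Set (Finset V), (E : Set (Finset V)) ⊆ A →
    (∀ m F s t, IsDoor d 𝓕 m s t → F.card + 1 = d → F ⊆ m →
      ReflTransGen (Cross d 𝓕 A F) s t → m ∈ A) →
    ∀ m s t, IsDoor d 𝓕 m s t → m ∈ A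

variable {d : ℕ} {𝓕 E : Finset (Finset V)}

theorem Cross.symm {A : Set (Finset V)} {F a b : Finset V} (h : Cross d 𝓕 A F a b) :
    Cross d 𝓕 A F b a := by
  obtain ⟨ha, hb, hab, m, hm, hd, hF, hma, hmb⟩ := h
  exact ⟨hb, ha, hab.symm, m, hm, hd, hF, hmb, hma⟩

theorem Cross.mono {A B : Set (Finset V)} (hAB : A ⊆ B) {F a b : Finset V}
    (h : Cross d 𝓕 A F a b) : Cross d 𝓕 B F a b := by
  obtain ⟨ha, hb, hab, m, hm, hd, hF, hma, hmb⟩ := h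
  exact ⟨ha, hb, hab, m, hAB hm, hd, hF, hma, hmb⟩

theorem reach_symm {A : Set (Finset V)} {F a b : Finset V}
    (h : ReflTransGen (Cross d 𝓕 A F) a b) : ReflTransGen (Cross d 𝓕 A F) b a :=
  by
  induction h with
  | refl => exact .refl
  | tail _ hc ih => exact .head hc.symm ih

theorem reach_mono {A B : Set (Finset V)} (hAB : A ⊆ B) {F a b : Finset V}
    (h : ReflTransGen (Cross d 𝓕 A F) a b) : ReflTransGen (Cross d 𝓕 B F) a b :=
  ReflTransGen.mono (fun _ _ => Cross.mono hAB) _ _ h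

theorem subset_of_reach {A : Set (Finset V)} {F a b : Finset V} (ha : F ⊆ a)
    (h : ReflTransGen (Cross d 𝓕 A F) a b) : F ⊆ b := by
  induction h with
  | refl => exact ha
  | tail _ h _ =>
    obtain ⟨_, _, _, m, _, _, hF, _, hm⟩ := h
    exact hF.trans hm

theorem mem_of_reach {A : Set (Finset V)} {F a b : Finset V} (ha : a ∈ 𝓕)
    (h : ReflTransGen (Cross d 𝓕 A F) a b) : b ∈ 𝓕 := by
  induction h with
  | refl => exact ha
  | tail _ h _ => exact h.2.1

variable [DecidableEq V]

/-- A simplex has only two codimension-one faces that contain a given codimension-two face. -/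
theorem eq_of_two_sides {g F x y z : Finset V} (hg : g.card = d + 1) (hF : F.card + 1 = d)
    (hx : x.card = d) (hy : y.card = d) (hz : z.card = d) (hFx : F ⊆ x) (hFy : F ⊆ y) (hFz : F ⊆ z)
    (hxg : x ⊆ g) (hyg : y ⊆ g) (hzg : z ⊆ g) (hyx : y ≠ x) (hzx : z ≠ x) : y = z := by
  have key : ∀ w : Finset V, w.card = d → F ⊆ w → w ⊆ g →
      ∃ p, p ∈ g \ F ∧ w = g.erase p := by
    intro w hw hFw hwg
    have h1 : (g \ w).card = 1 := by rw [Finset.card_sdiff_of_subset hwg]; omega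
    obtain ⟨p, hp⟩ := Finset.card_eq_one.1 h1
    have hpm : p ∈ g \ w := by simp [hp]
    rw [Finset.mem_sdiff] at hpm
    refine ⟨p, Finset.mem_sdiff.2 ⟨hpm.1, fun h => hpm.2 (hFw h)⟩, ?_⟩
    rw [Finset.erase_eq, ← hp, Finset.sdiff_sdiff_eq_self hwg]
  obtain ⟨p, hp, rfl⟩ := key x hx hFx hxg
  obtain ⟨q, hq, rfl⟩ := key y hy hFy hyg
  obtain ⟨r, hr, rfl⟩ := key z hz hFz hzg
  by_contra hne
  have hqp : q ≠ p := fun h => hyx (by rw [h])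
  have hrp : r ≠ p := fun h => hzx (by rw [h])
  have hqr : q ≠ r := fun h => hne (by rw [h])
  have h3 : ({p, q, r} : Finset V).card = 3 := by
    rw [Finset.card_eq_three]; exact ⟨p, q, r, hqp.symm, hrp.symm, hqr, rfl⟩
  have h2 : (g \ F).card = 2 := by
    rw [Finset.card_sdiff_of_subset (hFx.trans hxg)]; omega
  have := Finset.card_le_card (show ({p, q, r} : Finset V) ⊆ g \ F by
    intro u hu
    simp only [Finset.mem_insert, Finset.mem_singleton] at hu
    rcases hu with rfl | rfl | rfl <;> assumption)
  omega

theorem exists_other_side {g F x : Finset V} (hg : g.card = d + 1) (hF : F.card + 1 = d)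
    (hx : x.card = d) (hFx : F ⊆ x) (hxg : x ⊆ g) :
    ∃ y, y ≠ x ∧ y.card = d ∧ F ⊆ y ∧ y ⊆ g := by
  obtain ⟨w, hw⟩ : (x \ F).Nonempty := by
    rw [← Finset.card_pos, Finset.card_sdiff_of_subset hFx]; omega
  rw [Finset.mem_sdiff] at hw
  refine ⟨g.erase w, fun h => ?_, ?_, ?_, Finset.erase_subset _ _⟩
  · rw [← h] at hw; simp at hw
  · rw [Finset.card_erase_of_mem (hxg hw.1)]; omega
  · exact fun u hu => Finset.mem_erase.2 ⟨fun h => hw.2 (h ▸ hu), hxg (hFx hu)⟩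

/-- One step of the walk around `F`: from the facet `p.1`, about to be left through its side `p.2`, to
the facet beyond this side, about to be left through its other side that contains `F`. -/
def Next (d : ℕ) (𝓕 : Finset (Finset V)) (A : Set (Finset V)) (F : Finset V)
    (p q : Finset V × Finset V) : Prop :=
  p.2 ∈ A ∧ p.2.card = d ∧ F ⊆ p.2 ∧ p.2 ⊆ p.1 ∧ p.2 ⊆ q.1 ∧ q.1 ≠ p.1 ∧ p.1 ∈ 𝓕 ∧ q.1 ∈ 𝓕 ∧
    q.2 ≠ p.2 ∧ q.2.card = d ∧ F ⊆ q.2 ∧ q.2 ⊆ q.1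

namespace IsConstructible

variable (h : IsConstructible d 𝓕 E)
include h

theorem next_rightUnique {A : Set (Finset V)} {F : Finset V} (hF : F.card + 1 = d) :
    Relator.RightUnique (Next d 𝓕 A F) := by
  rintro ⟨g, x⟩ ⟨g₁, x₁⟩ ⟨g₂, x₂⟩ ⟨_, a2, a3, a4, a5, a6, a7, a8, a9, a10, a11, a12⟩
    ⟨_, b2, b3, b4, b5, b6, b7, b8, b9, b10, b11, b12⟩
  dsimp only at *
  obtain rfl : g₁ = g₂ := h.eq_of_three x g g₁ g₂ a2 a7 a8 b8 a4 a5 b5 a6 b6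
  obtain rfl : x₁ = x₂ := eq_of_two_sides (h.card_facet _ a8) hF a2 a10 b10 a3 a11 b11 a5 a12 b12 a9 b9
  rfl

/-- All facets that can be reached around `F` lie on the walk around `F` that starts at `s` and leaves
it through the side `e`, provided that the other side of `s` is closed. -/
theorem exists_next_of_reach {A : Set (Finset V)} {F m s e g : Finset V} (hF : F.card + 1 = d)
    (hs : s ∈ 𝓕) (hm : m.card = d) (hFm : F ⊆ m) (hms : m ⊆ s) (hmA : m ∉ A)
    (he : e.card = d) (hFe : F ⊆ e) (hes : e ⊆ s) (hem : e ≠ m)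
    (hg : ReflTransGen (Cross d 𝓕 A F) s g) :
    ∃ x, ReflTransGen (Next d 𝓕 A F) (s, e) (g, x) ∧ x.card = d ∧ F ⊆ x ∧ x ⊆ g := by
  induction hg with
  | refl => exact ⟨e, .refl, he, hFe, hes⟩
  | tail hpre hc ih =>
    rename_i g g'
    obtain ⟨hg, hg', hgg', m₁, hm₁A, hm₁, hFm₁, hm₁g, hm₁g'⟩ := hc
    obtain ⟨x, hx, hxc, hFx, hxg⟩ := ih
    by_cases hxm : x = m₁
    · subst hxm
      obtain ⟨y, hyx, hy, hFy, hyg'⟩ := exists_other_side (h.card_facet _ hg') hF hxc hFx hm₁g'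
      exact ⟨y, hx.tail ⟨hm₁A, hxc, hFx, hxg, hm₁g', hgg'.symm, hg, hg', hyx, hy, hFy, hyg'⟩,
        hy, hFy, hyg'⟩
    · rcases ReflTransGen.cases_tail hx with heq | ⟨⟨g'', x''⟩, hx'', hn⟩
      · obtain ⟨rfl, rfl⟩ := Prod.mk.inj heq
        exact absurd hm₁A (by
          rw [eq_of_two_sides (h.card_facet _ hs) hF hxc hm₁ hm hFx hFm₁ hFm hxg hm₁g hms
            (Ne.symm hxm) hem.symm]
          exact hmA)
      · obtain ⟨a1, a2, a3, a4, a5, a6, a7, a8, a9, a10, a11, a12⟩ := hn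
        dsimp only at *
        obtain rfl : m₁ = x'' := eq_of_two_sides (h.card_facet _ hg) hF hxc hm₁ a2 hFx hFm₁ a3 hxg
          hm₁g a5 (Ne.symm hxm) a9.symm
        obtain rfl : g' = g'' := h.eq_of_three m₁ g g' g'' hm₁ hg hg' a7 hm₁g hm₁g' a4 hgg'.symm a6.symm
        exact ⟨m₁, hx'', hm₁, hFm₁, a4⟩

/-- If the facets on the two sides of a closed face `m` can be reached from each other around `F`, then
`m` is the only closed side of all facets that can be reached. -/
theorem eq_of_closed_side {A : Set (Finset V)} {F m s t g m' : Finset V} (hF : F.card + 1 = d)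
    (hm : IsDoor d 𝓕 m s t) (hFm : F ⊆ m) (hmA : m ∉ A)
    (hst : ReflTransGen (Cross d 𝓕 A F) s t) (hsg : ReflTransGen (Cross d 𝓕 A F) s g)
    (hm' : m'.card = d) (hFm' : F ⊆ m') (hm'g : m' ⊆ g) (hm'A : m' ∉ A) : m' = m := by
  obtain ⟨hmc, hs, ht, hne, hms, hmt⟩ := hm
  obtain ⟨e, hem, he, hFe, hes⟩ := exists_other_side (h.card_facet _ hs) hF hmc hFm hms
  have hgF : g ∈ 𝓕 := mem_of_reach hs hsg
  have hterm : ∀ (p : Finset V × Finset V) (q), p.2 ∉ A →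
      ReflTransGen (Next d 𝓕 A F) p q → p = q := by
    intro p q hp hpq
    rcases ReflTransGen.cases_head hpq with h | ⟨_, hn, _⟩
    · exact h
    · exact absurd hn.1 hp
  -- A closed side of a facet that is reached by at least one step is the side about to be left.
  have hlast : ∀ g x m', ReflTransGen (Next d 𝓕 A F) (s, e) (g, x) → (s, e) ≠ (g, x) →
      x ⊆ g → m'.card = d → F ⊆ m' → m' ⊆ g → m' ∉ A → m' = x := by
    intro g x m' hx hnex hxg hm' hFm' hm'g hm'A
    rcases ReflTransGen.cases_tail hx with heq | ⟨⟨g'', x''⟩, hx'', hn⟩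
    · exact absurd heq.symm hnex
    · obtain ⟨a1, a2, a3, a4, a5, a6, a7, a8, a9, a10, a11, a12⟩ := hn
      dsimp only at *
      exact eq_of_two_sides (h.card_facet _ a8) hF a2 hm' a10 a3 hFm' a11 a5 hm'g a12
        (fun hh => hm'A (hh ▸ a1)) a9
  obtain ⟨x, hx, -, -, hxt⟩ := h.exists_next_of_reach hF hs hmc hFm hms hmA he hFe hes hem hst
  obtain rfl : m = x := hlast t x m hx (fun hh => hne (Prod.mk.inj hh).1) hxt hmc hFm hmt hmA
  obtain ⟨y, hy, -, -, hyg⟩ := h.exists_next_of_reach hF hs hmc hFm hms hmA he hFe hes hem hsg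
  by_cases hse : (s, e) = (g, y)
  · obtain ⟨rfl, rfl⟩ := Prod.mk.inj hse
    by_contra hne'
    obtain rfl : e = m' := eq_of_two_sides (h.card_facet _ hs) hF hmc he hm' hFm hFe hFm' hms hes
      hm'g hem hne'
    exact hne (Prod.mk.inj (hterm _ _ hm'A hx)).1
  · obtain rfl : m' = y := hlast g y m' hy hse hyg hm' hFm' hm'g hm'A
    rcases ReflTransGen.total_of_right_unique (h.next_rightUnique hF) hx hy with hh | hh
    · exact (Prod.mk.inj (hterm _ _ hmA hh)).2.symm
    · exact (Prod.mk.inj (hterm _ _ hm'A hh)).2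

theorem eq_or_eq_of_isDoor {m s t a : Finset V} (hm : IsDoor d 𝓕 m s t) (ha : a ∈ 𝓕)
    (hma : m ⊆ a) : a = s ∨ a = t := by
  obtain ⟨hmc, hs, ht, hne, hms, hmt⟩ := hm
  by_cases has : a = s
  · exact .inl has
  · exact .inr (h.eq_of_three m s a t hmc hs ha ht hms hma hmt has hne.symm)

/-- A walk around `F` that uses a newly opened face `m` passes through both facets at `m`. -/
theorem reach_insert {A : Set (Finset V)} {F m s t : Finset V}
    (hst : ReflTransGen (Cross d 𝓕 (insert m A) F) s t) :
    ReflTransGen (Cross d 𝓕 A F) s t ∨ (F ⊆ m ∧ ∀ a ∈ 𝓕, m ⊆ a →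
      ReflTransGen (Cross d 𝓕 (insert m A) F) a s) := by
  induction hst with
  | refl => exact .inl .refl
  | tail hpre hc ih =>
    rename_i b c
    rcases ih with ih | ih
    · obtain ⟨hb, hc', hbc, m₁, hm₁, hm₁c, hFm₁, hm₁b, hm₁c'⟩ := id hc
      rcases hm₁ with rfl | hm₁
      · refine .inr ⟨hFm₁, fun a ha hma => ?_⟩
        have hbs := reach_symm (reach_mono (Set.subset_insert m₁ A) ih)
        rcases h.eq_or_eq_of_isDoor ⟨hm₁c, hb, hc', hbc, hm₁b, hm₁c'⟩ ha hma with rfl | rfl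
        · exact hbs
        · exact .head hc.symm hbs
      · exact .inl (ih.tail ⟨hb, hc', hbc, m₁, hm₁, hm₁c, hFm₁, hm₁b, hm₁c'⟩)
    · exact .inr ih

/-- Opening a face `m` between facets that are connected around `F` has no effect on the
connections around `F`. -/
theorem reach_of_reach_insert {A : Set (Finset V)} {F m s t a b : Finset V}
    (hm : IsDoor d 𝓕 m s t) (hst : ReflTransGen (Cross d 𝓕 A F) s t)
    (hab : ReflTransGen (Cross d 𝓕 (insert m A) F) a b) : ReflTransGen (Cross d 𝓕 A F) a b := by
  induction hab with
  | refl => exact .refl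
  | tail hpre hc ih =>
    rename_i b c
    obtain ⟨hb, hc', hbc, m₁, hm₁, hm₁c, hFm₁, hm₁b, hm₁c'⟩ := hc
    rcases hm₁ with rfl | hm₁
    · rcases h.eq_or_eq_of_isDoor hm hb hm₁b with rfl | rfl <;>
      rcases h.eq_or_eq_of_isDoor hm hc' hm₁c' with rfl | rfl
      · exact absurd rfl hbc
      · exact ih.trans hst
      · exact ih.trans (reach_symm hst)
      · exact absurd rfl hbc
    · exact ih.tail ⟨hb, hc', hbc, m₁, hm₁, hm₁c, hFm₁, hm₁b, hm₁c'⟩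

end IsConstructible

end FacetFamily

/-! ### Labelled simplices and the spanning tree -/

namespace FacetFamily

open Relation

variable {V : Type*} [DecidableEq V] {d : ℕ} {𝓕 E : Finset (Finset V)}

/-- The vertex set of the simplex whose vertices are labelled by `g`. -/
def facet (g : Fin (d + 1) → V) : Finset V := Finset.univ.image g

/-- The side of the simplex `g` opposite to the vertex with label `c`. -/
def side (g : Fin (d + 1) → V) (c : Fin (d + 1)) : Finset V := (Finset.univ.erase c).image g

theorem side_subset_facet (g : Fin (d + 1) → V) (c : Fin (d + 1)) : side g c ⊆ facet g :=
  Finset.image_subset_image (Finset.erase_subset _ _)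

theorem card_facet {g : Fin (d + 1) → V} (hg : g.Injective) : (facet g).card = d + 1 := by
  rw [facet, Finset.card_image_of_injective _ hg, Finset.card_univ, Fintype.card_fin]

theorem card_side {g : Fin (d + 1) → V} (hg : g.Injective) (c : Fin (d + 1)) :
    (side g c).card = d := by
  rw [side, Finset.card_image_of_injective _ hg, Finset.card_erase_of_mem (Finset.mem_univ _),
    Finset.card_univ, Fintype.card_fin, Nat.add_sub_cancel]

theorem side_congr {g g' : Fin (d + 1) → V} {c : Fin (d + 1)} (h : ∀ a, a ≠ c → g' a = g a) :
    side g' c = side g c :=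
  Finset.image_congr fun a ha => h a (Finset.ne_of_mem_erase ha)

theorem exists_labelling {f : Finset V} (hf : f.card = d + 1) :
    ∃ g : Fin (d + 1) → V, g.Injective ∧ facet g = f := by
  let e := (Finset.equivFinOfCardEq hf).symm
  refine ⟨fun a => e a, fun a b hab => e.injective (Subtype.ext hab), ?_⟩
  ext v
  simp only [facet, Finset.mem_image, Finset.mem_univ, true_and]
  exact ⟨fun ⟨a, ha⟩ => ha ▸ (e a).2, fun hv => ⟨e.symm ⟨v, hv⟩, by simp⟩⟩

theorem exists_eq_side {g : Fin (d + 1) → V} (hg : g.Injective) {m : Finset V}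
    (hm : m.card = d) (hmg : m ⊆ facet g) : ∃ c, m = side g c := by
  have h1 : (facet g \ m).card = 1 := by
    rw [Finset.card_sdiff_of_subset hmg, card_facet hg, hm]; omega
  obtain ⟨p, hp⟩ := Finset.card_eq_one.1 h1
  have hpm : p ∈ facet g \ m := by simp [hp]
  rw [Finset.mem_sdiff] at hpm
  obtain ⟨c, -, rfl⟩ := Finset.mem_image.1 hpm.1
  refine ⟨c, Finset.eq_of_subset_of_card_le (fun v hv => ?_) (by rw [hm, card_side hg])⟩
  obtain ⟨a, -, rfl⟩ := Finset.mem_image.1 (hmg hv)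
  exact Finset.mem_image_of_mem _ (Finset.mem_erase.2 ⟨fun h => hpm.2 (h ▸ hv), Finset.mem_univ _⟩)

theorem side_injective {g : Fin (d + 1) → V} (hg : g.Injective) : (side g).Injective := by
  intro c c' h
  by_contra hne
  have : g c ∈ side g c' := Finset.mem_image_of_mem _ (by simp [hne])
  rw [← h] at this
  obtain ⟨a, ha, hac⟩ := Finset.mem_image.1 this
  exact (Finset.ne_of_mem_erase ha) (hg hac)

/-- A simplex with `d` labels prescribed on a common side gets all its labels. -/
theorem exists_labelling_beyond {g : Fin (d + 1) → V} (hg : g.Injective) {c : Fin (d + 1)}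
    {f : Finset V} (hf : f.card = d + 1) (hs : side g c ⊆ f) :
    ∃ g' : Fin (d + 1) → V, g'.Injective ∧ facet g' = f ∧ ∀ a, a ≠ c → g' a = g a := by
  obtain ⟨v, hv⟩ : (f \ side g c).Nonempty := by
    rw [← Finset.card_pos, Finset.card_sdiff_of_subset hs, card_side hg]; omega
  rw [Finset.mem_sdiff] at hv
  have hne : ∀ a, a ≠ c → g a ≠ v := fun a ha hav =>
    hv.2 (hav ▸ Finset.mem_image_of_mem _ (by simp [ha]))
  have hinj : (Function.update g c v).Injective := by
    intro a b hab
    by_cases ha : a = c <;> by_cases hb : b = c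
    · rw [ha, hb]
    · subst ha; simp [hb] at hab; exact absurd hab.symm (hne b hb)
    · subst hb; simp [ha] at hab; exact absurd hab (hne a ha)
    · simp [ha, hb] at hab; exact hg hab
  refine ⟨_, hinj, ?_, fun a ha => by simp [ha]⟩
  refine Finset.eq_of_subset_of_card_le (fun u hu => ?_) (by rw [hf, card_facet hinj])
  obtain ⟨a, -, rfl⟩ := Finset.mem_image.1 hu
  by_cases ha : a = c
  · subst ha; simpa using hv.1
  · simpa [ha] using hs (Finset.mem_image_of_mem g (by simp [ha]))

/-- The growth process of a tree of simplices. The simplices are numbered by `0, 1, 2, …`, and the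
state lists, for the simplices other than `0`, the number of an earlier simplex and the label of the
side along which the simplex has been attached to it. A question `(i, c)` asks whether a new simplex
is attached along the side `c` of simplex `i`. The new simplex has the same labels as simplex `i` on
the common side. -/
noncomputable def growTree (d : ℕ) (out : List (ℕ × Fin (d + 1))) (x : ℕ × Fin (d + 1)) :
    List (ℕ × Fin (d + 1)) × List (ℕ × Fin (d + 1)) :=
  (out ++ [x], ((Finset.univ.erase x.2).toList.map fun c => (out.length + 1, c)))

/-- `ℓ` labels distinct simplices of the family in accordance with the tree `out`. -/
structure IsPartialLabelling (𝓕 E : Finset (Finset V)) (out : List (ℕ × Fin (d + 1)))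
    (ℓ : ℕ → Fin (d + 1) → V) : Prop where
  injective : ∀ i ≤ out.length, (ℓ i).Injective
  facet_mem : ∀ i ≤ out.length, facet (ℓ i) ∈ 𝓕
  eq_of_facet_eq : ∀ i ≤ out.length, ∀ j ≤ out.length, facet (ℓ i) = facet (ℓ j) → i = j
  tree : ∀ (r : ℕ) i c, out[r]? = some (i, c) →
    i ≤ r ∧ (∀ a, a ≠ c → ℓ (r + 1) a = ℓ i a) ∧ side (ℓ i) c ∈ E

/-- `ℓ` labels all simplices of the family in accordance with the tree `out`, which uses all faces
of `E`. -/
structure IsLabelling (𝓕 E : Finset (Finset V)) (out : List (ℕ × Fin (d + 1)))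
    (ℓ : ℕ → Fin (d + 1) → V) : Prop extends IsPartialLabelling 𝓕 E out ℓ where
  card : out.length + 1 = 𝓕.card
  exists_facet : ∀ f ∈ 𝓕, ∃ i ≤ out.length, facet (ℓ i) = f
  card_edges : E.card + 1 = 𝓕.card
  exists_side : ∀ m ∈ E, ∃ (r : ℕ) (i : ℕ) (c : Fin (d + 1)), out[r]? = some (i, c) ∧ side (ℓ i) c = m

/-- The queue contains all sides beyond which the tree has still to be explored, and `n` simplices
are missing. -/
def TreeInv (𝓕 E : Finset (Finset V)) (n : ℕ) (out Q : List (ℕ × Fin (d + 1))) : Prop :=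
  ∃ ℓ : ℕ → Fin (d + 1) → V, IsPartialLabelling 𝓕 E out ℓ ∧ out.length + 1 + n = 𝓕.card ∧
    (∀ x ∈ Q, x.1 ≤ out.length) ∧
    ∀ i ≤ out.length, ∀ c, ∀ f ∈ 𝓕, f ≠ facet (ℓ i) → side (ℓ i) c ⊆ f → side (ℓ i) c ∈ E →
      (i, c) ∈ Q ∨ ∃ j ≤ out.length, facet (ℓ j) = f

namespace IsConstructible

/-- A question is answered positively if there is a simplex beyond the side, attached along a
face of the tree, that has not been reached before. -/
theorem treeInv_step (h : IsConstructible d 𝓕 E) (n : ℕ) (out : List (ℕ × Fin (d + 1)))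
    (x : ℕ × Fin (d + 1)) (Q : List (ℕ × Fin (d + 1))) (hI : TreeInv 𝓕 E n out (x :: Q)) :
    TreeInv 𝓕 E n out Q ∨ ∃ n', n = n' + 1 ∧ (growTree d out x).2.length ≤ d ∧
      TreeInv 𝓕 E n' (growTree d out x).1 (Q ++ (growTree d out x).2) := by
  obtain ⟨i, c⟩ := x
  obtain ⟨ℓ, hℓ, hn, hQ, hcl⟩ := hI
  have hi : i ≤ out.length := hQ (i, c) (by simp)
  by_cases hx : ∃ f ∈ 𝓕, f ≠ facet (ℓ i) ∧ side (ℓ i) c ⊆ f ∧ side (ℓ i) c ∈ E ∧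
      ∀ j ≤ out.length, facet (ℓ j) ≠ f
  swap
  · refine .inl ⟨ℓ, hℓ, hn, fun x hx => hQ x (by simp [hx]), fun i' hi' c' f hf hne hs hE => ?_⟩
    rcases hcl i' hi' c' f hf hne hs hE with hmem | hj
    · rcases List.mem_cons.1 hmem with heq | hmem
      · obtain ⟨rfl, rfl⟩ := Prod.mk.inj heq
        refine .inr ?_
        by_contra hcon
        exact hx ⟨f, hf, hne, hs, hE, fun j hj hjf => hcon ⟨j, hj, hjf⟩⟩
      · exact .inl hmem
    · exact .inr hj
  obtain ⟨f, hf, hfne, hfs, hfE, hfnew⟩ := hx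
  obtain ⟨g, hg, rfl, hgℓ⟩ := exists_labelling_beyond (hℓ.injective i hi) (h.card_facet f hf) hfs
  have hn' : out.length + 1 < 𝓕.card := by
    have : (insert (facet g) ((Finset.range (out.length + 1)).image fun j => facet (ℓ j))).card ≤
        𝓕.card := by
      refine Finset.card_le_card fun u hu => ?_
      rcases Finset.mem_insert.1 hu with rfl | hu
      · exact hf
      · obtain ⟨j, hj, rfl⟩ := Finset.mem_image.1 hu
        exact hℓ.facet_mem j (by simpa [Nat.lt_succ_iff] using hj)
    rw [Finset.card_insert_of_notMem, Finset.card_image_of_injOn, Finset.card_range] at this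
    · omega
    · intro a ha b hb hab
      simp only [Finset.coe_range, Set.mem_Iio, Nat.lt_succ_iff] at ha hb
      exact hℓ.eq_of_facet_eq a ha b hb hab
    · intro hu
      obtain ⟨j, hj, hjg⟩ := Finset.mem_image.1 hu
      exact hfnew j (by simpa [Nat.lt_succ_iff] using hj) hjg
  refine .inr ⟨n - 1, by omega, by simp [growTree, Finset.card_erase_of_mem], ?_⟩
  set ℓ' := Function.update ℓ (out.length + 1) g with hℓ'
  have hold : ∀ j ≤ out.length, ℓ' j = ℓ j := fun j hj => by
    rw [hℓ', Function.update_of_ne (by omega)]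
  have hnew : ℓ' (out.length + 1) = g := by simp [hℓ']
  have hsplit : ∀ j ≤ (growTree d out (i, c)).1.length, j ≤ out.length ∨ j = out.length + 1 := by
    intro j hj
    simp [growTree] at hj
    omega
  refine ⟨ℓ', ⟨fun j hj => ?_, fun j hj => ?_, fun j hj k hk hjk => ?_, fun r j c' hr => ?_⟩,
    by simp [growTree]; omega, fun y hy => ?_, fun j hj c' f hf' hne hs hE => ?_⟩
  · rcases hsplit j hj with hj | rfl
    · rw [hold j hj]; exact hℓ.injective j hj
    · rwa [hnew]
  · rcases hsplit j hj with hj | rfl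
    · rw [hold j hj]; exact hℓ.facet_mem j hj
    · rwa [hnew]
  · rcases hsplit j hj with hj | rfl <;> rcases hsplit k hk with hk | rfl
    · rw [hold j hj, hold k hk] at hjk; exact hℓ.eq_of_facet_eq j hj k hk hjk
    · rw [hold j hj, hnew] at hjk; exact absurd hjk (hfnew j hj)
    · rw [hold k hk, hnew] at hjk; exact absurd hjk.symm (hfnew k hk)
    · rfl
  · rcases lt_trichotomy r out.length with hlt | rfl | hlt
    · rw [growTree, List.getElem?_append_left hlt] at hr
      obtain ⟨h1, h2, h3⟩ := hℓ.tree r j c' hr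
      rw [hold (r + 1) (by omega), hold j (by omega)]
      exact ⟨h1, h2, h3⟩
    · simp [growTree] at hr
      obtain ⟨rfl, rfl⟩ := hr
      rw [hnew, hold i hi]
      exact ⟨hi, hgℓ, hfE⟩
    · rw [growTree, List.getElem?_eq_none (by simp; omega)] at hr
      simp at hr
  · rcases List.mem_append.1 hy with hy | hy
    · have := hQ y (by simp [hy]); simp [growTree]; omega
    · simp [growTree] at hy ⊢
      obtain ⟨_, _, rfl⟩ := hy; simp
  · have hvis : ∀ u, (∃ j ≤ out.length, facet (ℓ j) = u) ∨ u = facet g →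
        ∃ j ≤ (growTree d out (i, c)).1.length, facet (ℓ' j) = u := by
      rintro u (⟨j, hj, rfl⟩ | rfl)
      · exact ⟨j, by simp [growTree]; omega, by rw [hold j hj]⟩
      · exact ⟨out.length + 1, by simp [growTree], by rw [hnew]⟩
    have hd' := card_side (hℓ.injective i hi) c
    rcases hsplit j hj with hj | rfl
    · rw [hold j hj] at hne hs hE
      rcases hcl j hj c' f hf' hne hs hE with hmem | hj'
      · rcases List.mem_cons.1 hmem with heq | hmem
        · obtain ⟨rfl, rfl⟩ := Prod.mk.inj heq
          exact .inr (hvis _ (.inr (h.eq_of_three _ _ _ _ hd' (hℓ.facet_mem j hi) hf' hf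
            (side_subset_facet _ _) hs hfs hne hfne)))
        · exact .inl (by simp [hmem])
      · exact .inr (hvis _ (.inl hj'))
    · rw [hnew] at hne hs hE
      by_cases hcc : c' = c
      · subst hcc
        rw [side_congr hgℓ] at hs hE
        exact .inr (hvis _ (.inl ⟨i, hi, h.eq_of_three _ (facet g) _ _ hd' hf (hℓ.facet_mem i hi) hf'
          hfs (side_subset_facet _ _) hs hfne.symm hne⟩))
      · exact .inl (by simp [growTree, hcc])

theorem isLabelling_of_treeInv (h : IsConstructible d 𝓕 E) {n : ℕ} {out : List (ℕ × Fin (d + 1))}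
    (hI : TreeInv 𝓕 E n out []) : ∃ ℓ, IsLabelling 𝓕 E out ℓ := by
  obtain ⟨ℓ, hℓ, hn, -, hcl⟩ := hI
  have hsurj : ∀ f ∈ 𝓕, ∃ i ≤ out.length, facet (ℓ i) = f := by
    intro f hf
    have hr := h.connected _ (hℓ.facet_mem 0 (Nat.zero_le _)) f hf
    induction hr with
    | refl => exact ⟨0, Nat.zero_le _, rfl⟩
    | tail hpre hc ih =>
      obtain ⟨hb, hc', hbc, m, hm, hmc, -, hmb, hmc'⟩ := hc
      obtain ⟨i, hi, rfl⟩ := ih hb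
      obtain ⟨c, rfl⟩ := exists_eq_side (hℓ.injective i hi) hmc hmb
      rcases hcl i hi c _ hc' hbc.symm hmc' hm with hh | hh
      · simp at hh
      · exact hh
  have hcard : out.length + 1 = 𝓕.card := by
    refine le_antisymm (by omega) ?_
    calc 𝓕.card ≤ ((Finset.range (out.length + 1)).image fun j => facet (ℓ j)).card := by
          refine Finset.card_le_card fun f hf => ?_
          obtain ⟨i, hi, rfl⟩ := hsurj f hf
          exact Finset.mem_image_of_mem _ (by simpa [Nat.lt_succ_iff] using hi)
      _ ≤ out.length + 1 := Finset.card_image_le.trans (by simp)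
  -- The sides along which the simplices have been attached are distinct, and `E` has no more faces.
  let S : Fin out.length → Finset V := fun r => side (ℓ (out[r]).1) (out[r]).2
  have hget : ∀ r : Fin out.length, out[(r : ℕ)]? = some ((out[r]).1, (out[r]).2) := fun r => by simp
  have hdoor : ∀ r : Fin out.length, IsDoor d 𝓕 (S r) (facet (ℓ (out[r]).1)) (facet (ℓ (r + 1))) := by
    intro r
    obtain ⟨h1, h2, h3⟩ := hℓ.tree r _ _ (hget r)
    have hr := r.2
    refine ⟨card_side (hℓ.injective _ (by omega)) _, hℓ.facet_mem _ (by omega),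
      hℓ.facet_mem _ (by omega), fun hh => ?_, side_subset_facet _ _, ?_⟩
    · have := hℓ.eq_of_facet_eq _ (by omega) _ (by omega) hh; omega
    · rw [show S r = side (ℓ (r + 1)) (out[r]).2 from (side_congr h2).symm]
      exact side_subset_facet _ _
  have hSlt : ∀ r r' : Fin out.length, r < r' → S r ≠ S r' := by
    intro r r' hlt heq
    have h1 := (hℓ.tree r _ _ (hget r)).1
    have hr := r'.2
    have hlt' : (r : ℕ) < r' := hlt
    have hd' := hdoor r'
    rw [← heq] at hd'
    rcases h.eq_or_eq_of_isDoor (hdoor r) hd'.2.2.1 hd'.2.2.2.2.2 with hh | hh <;>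
    · have := hℓ.eq_of_facet_eq _ (by omega) _ (by omega) hh; omega
  have hSinj : S.Injective := by
    intro r r' heq
    rcases lt_trichotomy r r' with hlt | rfl | hlt
    · exact absurd heq (hSlt r r' hlt)
    · rfl
    · exact absurd heq.symm (hSlt r' r hlt)
  have himg : Finset.univ.image S = E := by
    refine Finset.eq_of_subset_of_card_le (fun m hm => ?_) ?_
    · obtain ⟨r, -, rfl⟩ := Finset.mem_image.1 hm
      exact (hℓ.tree r _ _ (hget r)).2.2
    · rw [Finset.card_image_of_injective _ hSinj, Finset.card_univ, Fintype.card_fin]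
      have := h.card_tree
      omega
  refine ⟨ℓ, hℓ, hcard, hsurj, ?_, fun m hm => ?_⟩
  · rw [← hcard, ← himg, Finset.card_image_of_injective _ hSinj, Finset.card_univ, Fintype.card_fin]
  rw [← himg] at hm
  obtain ⟨r, -, rfl⟩ := Finset.mem_image.1 hm
  exact ⟨r, _, _, hget r, rfl⟩

/-- The tree of simplices is given by a code. -/
theorem exists_tree_code (h : IsConstructible d 𝓕 E) :
    ∃ bs ∈ QueueProcess.codes (d * 𝓕.card + 1) (𝓕.card - 1), ∃ ℓ, IsLabelling 𝓕 E
      (QueueProcess.run (growTree d) [] (Finset.univ.toList.map fun c => (0, c)) bs) ℓ := by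
  have hcard := h.card_tree
  have hI : TreeInv 𝓕 E (𝓕.card - 1) ([] : List (ℕ × Fin (d + 1)))
      (Finset.univ.toList.map fun c => (0, c)) := by
    obtain ⟨f, hf⟩ : 𝓕.Nonempty := by rw [← Finset.card_pos]; omega
    obtain ⟨g, hg, rfl⟩ := exists_labelling (h.card_facet f hf)
    refine ⟨fun _ => g, ⟨fun _ _ => hg, fun _ _ => hf, fun i hi j hj _ => ?_, by simp⟩, ?_, by simp, ?_⟩
    · simp at hi hj; omega
    · simp; omega
    · intro i hi c f hf _ _ _
      simp at hi; simp [hi]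
  obtain ⟨bs, hbs, n, hn⟩ := QueueProcess.exists_code (growTree d) d (TreeInv 𝓕 E) h.treeInv_step
    (d * 𝓕.card + 1) (𝓕.card - 1) _ _ (by
      obtain ⟨k, hk⟩ : ∃ k, 𝓕.card = k + 1 := ⟨𝓕.card - 1, by omega⟩
      rw [hk]; simp; ring_nf; omega) hI
  exact ⟨bs, hbs, h.isLabelling_of_treeInv hn⟩

end IsConstructible

end FacetFamily

/-! ### The process of identifications -/

namespace FacetFamily

open Relation

section Gluing

variable {d : ℕ} {ι : Type*}

/-- A label `x.2.2` of the simplex `x.1`, seen from the side of this simplex opposite to the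
label `x.2.1`. -/
abbrev Flag (d : ℕ) (ι : Type*) : Type _ := ι × Fin (d + 1) × Fin (d + 1)

/-- A simplex with a set of labels. -/
abbrev Corner (d : ℕ) (ι : Type*) : Type _ := ι × Finset (Fin (d + 1))

/-- The side `c` of the simplex `i` has been glued to another side. -/
def IsGlued (G : Set (Flag d ι × Flag d ι)) (i : ι) (c : Fin (d + 1)) : Prop :=
  ∃ a y, ((i, c, a), y) ∈ G

/-- Two simplices are glued along sides that contain the faces `x.2` and `y.2`, and these faces are
glued to each other. -/
def CornerStep (G : Set (Flag d ι × Flag d ι)) (x y : Corner d ι) : Prop :=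
  ∃ c ∉ x.2, ∃ c' ∉ y.2, (∀ a ∈ x.2, ∃ b ∈ y.2, ((x.1, c, a), (y.1, c', b)) ∈ G) ∧
    ∀ b ∈ y.2, ∃ a ∈ x.2, ((x.1, c, a), (y.1, c', b)) ∈ G

/-- The side `c` of the simplex `i` is free, and it contains the face `S`, which is reached by walking
around the face `x`. -/
def IsEnd (G : Set (Flag d ι × Flag d ι)) (x : Corner d ι) (i : ι) (c : Fin (d + 1))
    (S : Finset (Fin (d + 1))) : Prop :=
  ReflTransGen (CornerStep G) x (i, S) ∧ c ∉ S ∧ ¬ IsGlued G i c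

/-- Two vertices are glued to each other along some sides. -/
def VertexStep (G : Set (Flag d ι × Flag d ι)) (u v : ι × Fin (d + 1)) : Prop :=
  ∃ c c', ((u.1, c, u.2), (v.1, c', v.2)) ∈ G

/-- The gluing of the two free sides at the ends of the walk around `x`: it extends the identification
of the copies of the face `x` on these sides. -/
def glueEnds (G : Set (Flag d ι × Flag d ι)) (x : Corner d ι) : Set (Flag d ι × Flag d ι) :=
  {p | ∃ S S', IsEnd G x p.1.1 p.1.2.1 S ∧ IsEnd G x p.2.1 p.2.2.1 S' ∧
    (p.1.1, p.1.2.1) ≠ (p.2.1, p.2.2.1) ∧ p.1.2.2 ≠ p.1.2.1 ∧ p.2.2.2 ≠ p.2.2.1 ∧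
    ((p.1.2.2 ∈ S ∧ p.2.2.2 ∈ S' ∧ EqvGen (VertexStep G) (p.1.1, p.1.2.2) (p.2.1, p.2.2.2)) ∨
      (p.1.2.2 ∉ S ∧ p.2.2.2 ∉ S'))}

variable [Fintype ι] [LinearOrder ι]

open Classical in
/-- The codimension-two faces around which walks are prolonged by the gluing of the ends of the walk
around `x`, one representative each: they are taken in the simplex with the smaller number. -/
noncomputable def newCorners (G : Set (Flag d ι × Flag d ι)) (x : Corner d ι) :
    Finset (Corner d ι) :=
  Finset.univ.filter fun y => ∃ c S j c' S', IsEnd G x y.1 c S ∧ IsEnd G x j c' S' ∧ y.1 < j ∧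
    y.2.card + 1 = d ∧ c ∉ y.2 ∧ y.2 ≠ S

open Classical in
/-- The codimension-two faces of the simplices that lie on a free side. -/
noncomputable def freeCorners (G : Set (Flag d ι × Flag d ι)) : Finset (Corner d ι) :=
  Finset.univ.filter fun y => y.2.card + 1 = d ∧ ∃ c ∉ y.2, ¬ IsGlued G y.1 c

/-- The process of identifications. A question `x` asks whether the two free sides at the ends of the
walk around the codimension-two face `x` are identified. -/
noncomputable def glueStep (G : Set (Flag d ι × Flag d ι)) (x : Corner d ι) :
    Set (Flag d ι × Flag d ι) × List (Corner d ι) :=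
  (G ∪ glueEnds G x, (newCorners G x).toList)

end Gluing

section Labelled

variable {V : Type*} [DecidableEq V] {d : ℕ} {𝓕 E : Finset (Finset V)} {ι : Type*}

/-- `ℓ` labels the facets of the family, each of them once. -/
structure IsFullLabelling (𝓕 : Finset (Finset V)) (ℓ : ι → Fin (d + 1) → V) : Prop where
  injective : ∀ i, (ℓ i).Injective
  facet_mem : ∀ i, facet (ℓ i) ∈ 𝓕
  eq_of_facet_eq : ∀ i j, facet (ℓ i) = facet (ℓ j) → i = j
  exists_facet : ∀ f ∈ 𝓕, ∃ i, facet (ℓ i) = f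

open Classical in
/-- The interior `(d-1)`-faces. -/
noncomputable def doors (d : ℕ) (𝓕 : Finset (Finset V)) : Finset (Finset V) :=
  (𝓕.biUnion Finset.powerset).filter fun m => ∃ s t, IsDoor d 𝓕 m s t

theorem mem_doors {m : Finset V} : m ∈ doors d 𝓕 ↔ ∃ s t, IsDoor d 𝓕 m s t := by
  simp only [doors, Finset.mem_filter, Finset.mem_biUnion, Finset.mem_powerset,
    and_iff_right_iff_imp]
  exact fun ⟨s, t, h⟩ => ⟨s, h.2.1, h.2.2.2.2.1⟩

/-- The gluing of labelled simplices along the faces of `A`. -/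
def gluing (ℓ : ι → Fin (d + 1) → V) (A : Set (Finset V)) : Set (Flag d ι × Flag d ι) :=
  {p | p.1.1 ≠ p.2.1 ∧ p.1.2.2 ≠ p.1.2.1 ∧ p.2.2.2 ≠ p.2.2.1 ∧
    side (ℓ p.1.1) p.1.2.1 = side (ℓ p.2.1) p.2.2.1 ∧ side (ℓ p.1.1) p.1.2.1 ∈ A ∧
    ℓ p.1.1 p.1.2.2 = ℓ p.2.1 p.2.2.2}

theorem mem_side {g : Fin (d + 1) → V} (hg : g.Injective) {a c : Fin (d + 1)} :
    g a ∈ side g c ↔ a ≠ c := by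
  simp [side, hg.eq_iff]

theorem image_subset_side {g : Fin (d + 1) → V} (hg : g.Injective) {S : Finset (Fin (d + 1))}
    {c : Fin (d + 1)} : S.image g ⊆ side g c ↔ c ∉ S := by
  constructor
  · intro h hc
    exact (mem_side hg).1 (h (Finset.mem_image_of_mem g hc)) rfl
  · intro hc
    exact Finset.image_subset_image fun a ha => Finset.mem_erase.2 ⟨fun h => hc (h ▸ ha), by simp⟩

theorem exists_image_eq {g : Fin (d + 1) → V} {F : Finset V} (hF : F ⊆ facet g) :
    ∃ S : Finset (Fin (d + 1)), S.image g = F := by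
  obtain ⟨S, -, hS⟩ := Finset.subset_image_iff.1 hF
  exact ⟨S, hS⟩

variable {ℓ : ι → Fin (d + 1) → V}

theorem IsFullLabelling.card_eq_of_image_eq (hℓ : IsFullLabelling 𝓕 ℓ) {i j : ι}
    {S S' : Finset (Fin (d + 1))}
    (h : S.image (ℓ i) = S'.image (ℓ j)) : S.card = S'.card := by
  rw [← Finset.card_image_of_injective S (hℓ.injective i), h,
    Finset.card_image_of_injective S' (hℓ.injective j)]

theorem eq_of_eqvGen {A : Set (Finset V)} {u v : ι × Fin (d + 1)}
    (h : EqvGen (VertexStep (gluing ℓ A)) u v) : ℓ u.1 u.2 = ℓ v.1 v.2 := by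
  induction h with
  | rel _ _ h => obtain ⟨c, c', h⟩ := h; exact h.2.2.2.2.2
  | refl => rfl
  | symm _ _ _ ih => exact ih.symm
  | trans _ _ _ _ _ ih1 ih2 => exact ih1.trans ih2

theorem exists_eqvGen_of_reach {G : Set (Flag d ι × Flag d ι)} {x y : Corner d ι}
    (h : ReflTransGen (CornerStep G) x y) {b : Fin (d + 1)} (hb : b ∈ y.2) :
    ∃ a ∈ x.2, EqvGen (VertexStep G) (x.1, a) (y.1, b) := by
  induction h generalizing b with
  | refl => exact ⟨b, hb, .refl _⟩
  | tail hpre hc ih =>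
    obtain ⟨c, -, c', -, -, h2⟩ := hc
    obtain ⟨a, ha, hab⟩ := h2 b hb
    obtain ⟨a', ha', h'⟩ := ih ha
    exact ⟨a', ha', .trans _ _ _ h' (.rel _ _ ⟨c, c', hab⟩)⟩

namespace IsFullLabelling

variable (hℓ : IsFullLabelling 𝓕 ℓ)
include hℓ

theorem exists_sides {m s t : Finset V} (hm : IsDoor d 𝓕 m s t) :
    ∃ i c j c', i ≠ j ∧ facet (ℓ i) = s ∧ facet (ℓ j) = t ∧ side (ℓ i) c = m ∧ side (ℓ j) c' = m := by
  obtain ⟨hmc, hs, ht, hne, hms, hmt⟩ := hm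
  obtain ⟨i, rfl⟩ := hℓ.exists_facet s hs
  obtain ⟨j, rfl⟩ := hℓ.exists_facet t ht
  obtain ⟨c, hc⟩ := exists_eq_side (hℓ.injective i) hmc hms
  obtain ⟨c', hc'⟩ := exists_eq_side (hℓ.injective j) hmc hmt
  exact ⟨i, c, j, c', fun h => hne (by rw [h]), rfl, rfl, hc.symm, hc'.symm⟩

theorem isDoor_of_side_eq {i j : ι} {c c' : Fin (d + 1)} (hij : i ≠ j)
    (hs : side (ℓ i) c = side (ℓ j) c') : IsDoor d 𝓕 (side (ℓ i) c) (facet (ℓ i)) (facet (ℓ j)) :=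
  ⟨card_side (hℓ.injective i) c, hℓ.facet_mem i, hℓ.facet_mem j,
    fun h => hij (hℓ.eq_of_facet_eq i j h), side_subset_facet _ _, hs ▸ side_subset_facet _ _⟩

theorem isGlued_iff (hd : 2 ≤ d) {A : Set (Finset V)}
    (hA : A ⊆ doors d 𝓕) {i : ι} {c : Fin (d + 1)} :
    IsGlued (gluing ℓ A) i c ↔ side (ℓ i) c ∈ A := by
  constructor
  · rintro ⟨a, y, hy⟩
    exact hy.2.2.2.2.1
  · intro hc
    obtain ⟨s, t, hst⟩ := mem_doors.1 (hA hc)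
    obtain ⟨i₁, c₁, i₂, c₂, hne, rfl, rfl, h1, h2⟩ := hℓ.exists_sides hst
    obtain ⟨j, c', hij, hjc⟩ : ∃ j c', i ≠ j ∧ side (ℓ i) c = side (ℓ j) c' := by
      by_cases hi : i = i₁
      · exact ⟨i₂, c₂, hi ▸ hne, h2.symm⟩
      · exact ⟨i₁, c₁, hi, h1.symm⟩
    obtain ⟨v, hv⟩ : (side (ℓ i) c).Nonempty := by
      rw [← Finset.card_pos, card_side (hℓ.injective i)]; omega
    obtain ⟨a, ha, rfl⟩ := Finset.mem_image.1 hv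
    rw [hjc] at hv
    obtain ⟨b, hb, hab⟩ := Finset.mem_image.1 hv
    exact ⟨a, (j, c', b), hij, Finset.ne_of_mem_erase ha, Finset.ne_of_mem_erase hb, hjc, hc, hab.symm⟩

theorem cornerStep_iff (hd : 2 ≤ d) {A : Set (Finset V)} {i j : ι} {S S' : Finset (Fin (d + 1))}
    (hS : S.card + 1 = d) : CornerStep (gluing ℓ A) (i, S) (j, S') ↔
      S.image (ℓ i) = S'.image (ℓ j) ∧ Cross d 𝓕 A (S.image (ℓ i)) (facet (ℓ i)) (facet (ℓ j)) := by
  constructor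
  · rintro ⟨c, hc, c', hc', h1, h2⟩
    dsimp only at *
    obtain ⟨a, ha⟩ : S.Nonempty := by rw [← Finset.card_pos]; omega
    obtain ⟨b, hb, hab⟩ := h1 a ha
    obtain ⟨hij, -, -, hside, hA, -⟩ := hab
    dsimp only at *
    have hdoor := hℓ.isDoor_of_side_eq hij hside
    refine ⟨?_, hdoor.2.1, hdoor.2.2.1, hdoor.2.2.2.1, _, hA, hdoor.1,
      (image_subset_side (hℓ.injective i)).2 hc, hdoor.2.2.2.2⟩
    ext v
    simp only [Finset.mem_image]
    constructor
    · rintro ⟨a, ha, rfl⟩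
      obtain ⟨b, hb, hab⟩ := h1 a ha
      exact ⟨b, hb, hab.2.2.2.2.2.symm⟩
    · rintro ⟨b, hb, rfl⟩
      obtain ⟨a, ha, hab⟩ := h2 b hb
      exact ⟨a, ha, hab.2.2.2.2.2⟩
  · rintro ⟨hSS', hi, hj, hne, m, hmA, hmc, hF, hmi, hmj⟩
    obtain ⟨c, rfl⟩ := exists_eq_side (hℓ.injective i) hmc hmi
    obtain ⟨c', hc'⟩ := exists_eq_side (hℓ.injective j) hmc hmj
    have hij : i ≠ j := fun h => hne (by rw [h])
    have hcS := (image_subset_side (hℓ.injective i)).1 hF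
    have hcS' : c' ∉ S' := by
      rw [hSS', hc'] at hF; exact (image_subset_side (hℓ.injective j)).1 hF
    have key : ∀ a ∈ S, ∀ b ∈ S', ℓ i a = ℓ j b → ((i, c, a), (j, c', b)) ∈ gluing ℓ A :=
      fun a ha b hb hab => ⟨hij, fun h => hcS (by dsimp only at h; exact h ▸ ha),
        fun h => hcS' (by dsimp only at h; exact h ▸ hb), hc', hmA, hab⟩
    refine ⟨c, hcS, c', hcS', fun a ha => ?_, fun b hb => ?_⟩
    · have : ℓ i a ∈ S'.image (ℓ j) := hSS' ▸ Finset.mem_image_of_mem _ ha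
      obtain ⟨b, hb, hab⟩ := Finset.mem_image.1 this
      exact ⟨b, hb, key a ha b hb hab.symm⟩
    · have : ℓ j b ∈ S.image (ℓ i) := hSS' ▸ Finset.mem_image_of_mem _ hb
      obtain ⟨a, ha, hab⟩ := Finset.mem_image.1 this
      exact ⟨a, ha, key a ha b hb hab⟩

/-- Walks in the labelled simplices are walks around a face of the complex. -/
theorem reach_corner_iff (hd : 2 ≤ d) {A : Set (Finset V)} {i j : ι} {S S' : Finset (Fin (d + 1))}
    (hS : S.card + 1 = d) : ReflTransGen (CornerStep (gluing ℓ A)) (i, S) (j, S') ↔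
      S.image (ℓ i) = S'.image (ℓ j) ∧
        ReflTransGen (Cross d 𝓕 A (S.image (ℓ i))) (facet (ℓ i)) (facet (ℓ j)) := by
  constructor
  · intro h
    generalize hy : (j, S') = y at h
    induction h generalizing j S' with
    | refl => obtain ⟨rfl, rfl⟩ := Prod.mk.inj hy; exact ⟨rfl, .refl⟩
    | tail hpre hc ih =>
      subst hy
      rename_i y
      obtain ⟨j₁, S₁⟩ := y
      obtain ⟨h1, h2⟩ := ih rfl
      have h3 := (hℓ.cornerStep_iff hd (by rw [← hℓ.card_eq_of_image_eq h1, hS])).1 hc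
      rw [← h1] at h3
      exact ⟨h3.1, h2.tail h3.2⟩
  · rintro ⟨h1, h2⟩
    generalize hg : facet (ℓ j) = g at h2
    induction h2 generalizing j S' with
    | refl =>
      obtain rfl := hℓ.eq_of_facet_eq _ _ hg
      obtain rfl := Finset.image_injective (hℓ.injective j) h1
      exact .refl
    | tail hpre hc ih =>
      subst hg
      rename_i b
      obtain ⟨k, rfl⟩ := hℓ.exists_facet b hc.1
      obtain ⟨T, hT⟩ := exists_image_eq
        (subset_of_reach (Finset.image_subset_image (Finset.subset_univ _)) hpre)
      refine (ih hT.symm rfl).tail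
        ((hℓ.cornerStep_iff hd (by rw [hℓ.card_eq_of_image_eq hT, hS])).2 ⟨hT.trans h1, ?_⟩)
      rwa [hT]

theorem isEnd_iff (hd : 2 ≤ d) {A : Set (Finset V)}
    (hA : A ⊆ doors d 𝓕) {i j : ι} {c : Fin (d + 1)} {S S' : Finset (Fin (d + 1))}
    (hS : S.card + 1 = d) : IsEnd (gluing ℓ A) (i, S) j c S' ↔
      S.image (ℓ i) = S'.image (ℓ j) ∧
        ReflTransGen (Cross d 𝓕 A (S.image (ℓ i))) (facet (ℓ i)) (facet (ℓ j)) ∧ c ∉ S' ∧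
        side (ℓ j) c ∉ A := by
  rw [IsEnd, hℓ.reach_corner_iff hd hS, hℓ.isGlued_iff hd hA, and_assoc]

end IsFullLabelling

/-- The situation in which the free sides at the ends of the walk around the face `S` of the simplex
`i` are to be identified: in the complex, they form the interior face `m`, between the simplices
`i₁` and `i₂`. -/
structure IsGluable (d : ℕ) (𝓕 : Finset (Finset V)) (ℓ : ι → Fin (d + 1) → V) (A : Set (Finset V))
    (i : ι) (S : Finset (Fin (d + 1))) (m : Finset V) (i₁ i₂ : ι) (c₁ c₂ : Fin (d + 1))
    (S₁ S₂ : Finset (Fin (d + 1))) : Prop where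
  card : S.card + 1 = d
  ne : i₁ ≠ i₂
  side_left : side (ℓ i₁) c₁ = m
  side_right : side (ℓ i₂) c₂ = m
  image_left : S₁.image (ℓ i₁) = S.image (ℓ i)
  image_right : S₂.image (ℓ i₂) = S.image (ℓ i)
  subset : S.image (ℓ i) ⊆ m
  notMem : m ∉ A
  reach_left : ReflTransGen (Cross d 𝓕 A (S.image (ℓ i))) (facet (ℓ i)) (facet (ℓ i₁))
  reach_right : ReflTransGen (Cross d 𝓕 A (S.image (ℓ i))) (facet (ℓ i)) (facet (ℓ i₂))

namespace IsGluable

variable {A : Set (Finset V)} {i i₁ i₂ : ι} {S S₁ S₂ : Finset (Fin (d + 1))} {m : Finset V}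
  {c₁ c₂ : Fin (d + 1)}

theorem symm (hm : IsGluable d 𝓕 ℓ A i S m i₁ i₂ c₁ c₂ S₁ S₂) :
    IsGluable d 𝓕 ℓ A i S m i₂ i₁ c₂ c₁ S₂ S₁ :=
  ⟨hm.card, hm.ne.symm, hm.side_right, hm.side_left, hm.image_right, hm.image_left, hm.subset,
    hm.notMem, hm.reach_right, hm.reach_left⟩

theorem isDoor (hm : IsGluable d 𝓕 ℓ A i S m i₁ i₂ c₁ c₂ S₁ S₂) (hℓ : IsFullLabelling 𝓕 ℓ) :
    IsDoor d 𝓕 m (facet (ℓ i₁)) (facet (ℓ i₂)) := by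
  have := hℓ.isDoor_of_side_eq hm.ne (hm.side_left.trans hm.side_right.symm)
  rwa [hm.side_left] at this

theorem isEnd_iff (hm : IsGluable d 𝓕 ℓ A i S m i₁ i₂ c₁ c₂ S₁ S₂) (hd : 2 ≤ d)
    (hℓ : IsFullLabelling 𝓕 ℓ) (h : IsConstructible d 𝓕 E) (hA : A ⊆ doors d 𝓕) {j : ι}
    {c : Fin (d + 1)} {T : Finset (Fin (d + 1))} :
    IsEnd (gluing ℓ A) (i, S) j c T ↔ (j = i₁ ∧ c = c₁ ∧ T = S₁) ∨ (j = i₂ ∧ c = c₂ ∧ T = S₂) := by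
  rw [hℓ.isEnd_iff hd hA hm.card]
  have hdoor := hm.isDoor hℓ
  have hF : (S.image (ℓ i)).card + 1 = d := by
    rw [Finset.card_image_of_injective _ (hℓ.injective i), hm.card]
  constructor
  · rintro ⟨h1, h2, h3, h4⟩
    have hside : side (ℓ j) c = m := h.eq_of_closed_side hF hdoor hm.subset hm.notMem
      ((reach_symm hm.reach_left).trans hm.reach_right) ((reach_symm hm.reach_left).trans h2)
      (card_side (hℓ.injective j) c) (by rw [h1]; exact (image_subset_side (hℓ.injective j)).2 h3)
      (side_subset_facet _ _) h4
    rcases h.eq_or_eq_of_isDoor hdoor (hℓ.facet_mem j) (hside ▸ side_subset_facet _ _) with hj | hj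
    · obtain rfl := hℓ.eq_of_facet_eq _ _ hj
      exact .inl ⟨rfl, side_injective (hℓ.injective j) (hside.trans hm.side_left.symm),
        Finset.image_injective (hℓ.injective j) (h1.symm.trans hm.image_left.symm)⟩
    · obtain rfl := hℓ.eq_of_facet_eq _ _ hj
      exact .inr ⟨rfl, side_injective (hℓ.injective j) (hside.trans hm.side_right.symm),
        Finset.image_injective (hℓ.injective j) (h1.symm.trans hm.image_right.symm)⟩
  · have key : ∀ {i₁ i₂ c₁ c₂ S₁ S₂}, IsGluable d 𝓕 ℓ A i S m i₁ i₂ c₁ c₂ S₁ S₂ →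
        S.image (ℓ i) = S₁.image (ℓ i₁) ∧
        ReflTransGen (Cross d 𝓕 A (S.image (ℓ i))) (facet (ℓ i)) (facet (ℓ i₁)) ∧ c₁ ∉ S₁ ∧
        side (ℓ i₁) c₁ ∉ A := by
      intro i₁ i₂ c₁ c₂ S₁ S₂ hm
      refine ⟨hm.image_left.symm, hm.reach_left, ?_, hm.side_left ▸ hm.notMem⟩
      rw [← image_subset_side (hℓ.injective i₁), hm.image_left, hm.side_left]
      exact hm.subset
    rintro (⟨rfl, rfl, rfl⟩ | ⟨rfl, rfl, rfl⟩)
    · exact key hm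
    · exact key hm.symm

theorem mem_left_iff (hm : IsGluable d 𝓕 ℓ A i S m i₁ i₂ c₁ c₂ S₁ S₂) (hℓ : IsFullLabelling 𝓕 ℓ)
    {a : Fin (d + 1)} : a ∈ S₁ ↔ ℓ i₁ a ∈ S.image (ℓ i) := by
  rw [← hm.image_left]
  simp [(hℓ.injective i₁).eq_iff]

/-- Opening the door `m` is the gluing of the two free sides at the ends of the walk. -/
theorem gluing_insert (hm : IsGluable d 𝓕 ℓ A i S m i₁ i₂ c₁ c₂ S₁ S₂) (hd : 2 ≤ d)
    (hℓ : IsFullLabelling 𝓕 ℓ) (h : IsConstructible d 𝓕 E) (hA : A ⊆ doors d 𝓕) :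
    gluing ℓ (insert m A) = gluing ℓ A ∪ glueEnds (gluing ℓ A) (i, S) := by
  have hdoor := hm.isDoor hℓ
  have hF : (S.image (ℓ i)).card + 1 = d := by
    rw [Finset.card_image_of_injective _ (hℓ.injective i), hm.card]
  have hsub : ∀ {i₁ i₂ c₁ c₂ S₁ S₂}, IsGluable d 𝓕 ℓ A i S m i₁ i₂ c₁ c₂ S₁ S₂ →
      ∀ a b, a ≠ c₁ → b ≠ c₂ → ℓ i₁ a = ℓ i₂ b →
      ((i₁, c₁, a), (i₂, c₂, b)) ∈ glueEnds (gluing ℓ A) (i, S) := by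
    intro i₁ i₂ c₁ c₂ S₁ S₂ hm a b ha hb hab
    have e1 : IsEnd (gluing ℓ A) (i, S) i₁ c₁ S₁ :=
      (hm.isEnd_iff hd hℓ h hA).2 (.inl ⟨rfl, rfl, rfl⟩)
    have e2 : IsEnd (gluing ℓ A) (i, S) i₂ c₂ S₂ :=
      (hm.isEnd_iff hd hℓ h hA).2 (.inr ⟨rfl, rfl, rfl⟩)
    refine ⟨S₁, S₂, e1, e2, fun hh => hm.ne (Prod.mk.inj hh).1, ha, hb, ?_⟩
    have hiff : a ∈ S₁ ↔ b ∈ S₂ := by rw [hm.mem_left_iff hℓ, hm.symm.mem_left_iff hℓ, hab]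
    by_cases haS : a ∈ S₁
    · refine .inl ⟨haS, hiff.1 haS, ?_⟩
      obtain ⟨a', ha', h1⟩ := exists_eqvGen_of_reach e1.1 haS
      obtain ⟨b', hb', h2⟩ := exists_eqvGen_of_reach e2.1 (hiff.1 haS)
      have : a' = b' := hℓ.injective i (by
        rw [eq_of_eqvGen h1, eq_of_eqvGen h2]; exact hab)
      subst this
      exact .trans _ _ _ (.symm _ _ h1) h2
    · exact .inr ⟨haS, fun hb => haS (hiff.2 hb)⟩
  have hsup : ∀ {i₁ i₂ c₁ c₂ S₁ S₂}, IsGluable d 𝓕 ℓ A i S m i₁ i₂ c₁ c₂ S₁ S₂ →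
      ∀ a b, a ≠ c₁ → b ≠ c₂ →
      ((a ∈ S₁ ∧ b ∈ S₂ ∧ EqvGen (VertexStep (gluing ℓ A)) (i₁, a) (i₂, b)) ∨ (a ∉ S₁ ∧ b ∉ S₂)) →
      ((i₁, c₁, a), (i₂, c₂, b)) ∈ gluing ℓ (insert m A) := by
    intro i₁ i₂ c₁ c₂ S₁ S₂ hm a b ha hb hab
    refine ⟨hm.ne, ha, hb, hm.side_left.trans hm.side_right.symm, .inl hm.side_left, ?_⟩
    dsimp only
    rcases hab with ⟨-, -, hab⟩ | ⟨haS, hbS⟩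
    · exact eq_of_eqvGen hab
    · have h1 : (m \ S.image (ℓ i)).card ≤ 1 := by
        rw [Finset.card_sdiff_of_subset hm.subset, hdoor.1]; omega
      refine Finset.card_le_one.1 h1 _ (Finset.mem_sdiff.2 ⟨?_, ?_⟩) _ (Finset.mem_sdiff.2 ⟨?_, ?_⟩)
      · rw [← hm.side_left, mem_side (hℓ.injective _)]; exact ha
      · rwa [← hm.mem_left_iff hℓ]
      · rw [← hm.side_right, mem_side (hℓ.injective _)]; exact hb
      · rwa [← hm.symm.mem_left_iff hℓ]
  ext ⟨⟨j, c, a⟩, k, c', b⟩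
  constructor
  · rintro ⟨hjk, ha, hb, hs, hin, hab⟩
    dsimp only at *
    rcases hin with hin | hin
    · right
      have hj := h.eq_or_eq_of_isDoor hdoor (hℓ.facet_mem j) (hin ▸ side_subset_facet _ _)
      have hk := h.eq_or_eq_of_isDoor hdoor (hℓ.facet_mem k) (hin ▸ hs ▸ side_subset_facet _ _)
      have key : ∀ {i₁ i₂ c₁ c₂ S₁ S₂}, IsGluable d 𝓕 ℓ A i S m i₁ i₂ c₁ c₂ S₁ S₂ →
          j = i₁ → k = i₂ → ((j, c, a), (k, c', b)) ∈ glueEnds (gluing ℓ A) (i, S) := by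
        rintro i₁ i₂ c₁ c₂ S₁ S₂ hm rfl rfl
        obtain rfl := side_injective (hℓ.injective j) (hin.trans hm.side_left.symm)
        obtain rfl := side_injective (hℓ.injective k) ((hs.symm.trans hin).trans hm.side_right.symm)
        exact hsub hm a b ha hb hab
      rcases hj with hj | hj <;> rcases hk with hk | hk <;>
        replace hj := hℓ.eq_of_facet_eq _ _ hj <;> replace hk := hℓ.eq_of_facet_eq _ _ hk
      · exact absurd (hj.trans hk.symm) hjk
      · exact key hm hj hk
      · exact key hm.symm hj hk
      · exact absurd (hj.trans hk.symm) hjk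
    · exact .inl ⟨hjk, ha, hb, hs, hin, hab⟩
  · rintro (⟨hjk, ha, hb, hs, hin, hab⟩ | ⟨T, T', e1, e2, hne, ha, hb, hab⟩)
    · exact ⟨hjk, ha, hb, hs, .inr hin, hab⟩
    · dsimp only at *
      rcases (hm.isEnd_iff hd hℓ h hA).1 e1 with ⟨rfl, rfl, rfl⟩ | ⟨rfl, rfl, rfl⟩ <;>
      rcases (hm.isEnd_iff hd hℓ h hA).1 e2 with ⟨rfl, rfl, rfl⟩ | ⟨rfl, rfl, rfl⟩
      · exact absurd rfl hne
      · exact hsup hm a b ha hb hab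
      · exact hsup hm.symm a b ha hb hab
      · exact absurd rfl hne

variable [Fintype ι] [LinearOrder ι]

theorem mem_newCorners (hm : IsGluable d 𝓕 ℓ A i S m i₁ i₂ c₁ c₂ S₁ S₂) (hlt : i₁ < i₂) (hd : 2 ≤ d)
    (hℓ : IsFullLabelling 𝓕 ℓ) (h : IsConstructible d 𝓕 E) (hA : A ⊆ doors d 𝓕) {y : Corner d ι} :
    y ∈ newCorners (gluing ℓ A) (i, S) ↔ y.1 = i₁ ∧ y.2.card + 1 = d ∧ c₁ ∉ y.2 ∧ y.2 ≠ S₁ := by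
  obtain ⟨j, T⟩ := y
  simp only [newCorners, Finset.mem_filter, Finset.mem_univ, true_and, hm.isEnd_iff hd hℓ h hA]
  constructor
  · rintro ⟨c, T', k, c', T'', h1, h2, h3, h4⟩
    rcases h1 with ⟨rfl, rfl, rfl⟩ | ⟨rfl, rfl, rfl⟩ <;>
      rcases h2 with ⟨rfl, rfl, rfl⟩ | ⟨rfl, rfl, rfl⟩
    · exact absurd h3 (lt_irrefl _)
    · exact ⟨rfl, h4⟩
    · exact absurd h3 hlt.not_gt
    · exact absurd h3 (lt_irrefl _)
  · rintro ⟨rfl, h4⟩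
    exact ⟨c₁, S₁, i₂, c₂, S₂, .inl ⟨rfl, rfl, rfl⟩, .inr ⟨rfl, rfl, rfl⟩, hlt, h4⟩

omit [Fintype ι] [LinearOrder ι] in
theorem card_left (hm : IsGluable d 𝓕 ℓ A i S m i₁ i₂ c₁ c₂ S₁ S₂) (hℓ : IsFullLabelling 𝓕 ℓ) :
    S₁.card + 1 = d := by
  rw [hℓ.card_eq_of_image_eq hm.image_left, hm.card]

theorem card_newCorners_le (hm : IsGluable d 𝓕 ℓ A i S m i₁ i₂ c₁ c₂ S₁ S₂) (hlt : i₁ < i₂)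
    (hd : 2 ≤ d) (hℓ : IsFullLabelling 𝓕 ℓ) (h : IsConstructible d 𝓕 E) (hA : A ⊆ doors d 𝓕) :
    (newCorners (gluing ℓ A) (i, S)).card ≤ d - 1 := by
  have hS₁ : S₁ ∈ (Finset.univ.erase c₁).powersetCard (d - 1) := by
    rw [Finset.mem_powersetCard]
    refine ⟨fun a ha => Finset.mem_erase.2 ⟨?_, by simp⟩, by have := hm.card_left hℓ; omega⟩
    rintro rfl
    have := (hm.mem_left_iff hℓ).1 ha
    have := hm.subset this
    rw [← hm.side_left, mem_side (hℓ.injective _)] at this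
    exact this rfl
  have hle : (newCorners (gluing ℓ A) (i, S)).card ≤
      (((Finset.univ.erase c₁).powersetCard (d - 1)).erase S₁).card := by
    refine Finset.card_le_card_of_injOn Prod.snd (fun y hy => ?_) (fun y hy z hz hyz => ?_)
    · obtain ⟨h1, h2, h3, h4⟩ := (hm.mem_newCorners hlt hd hℓ h hA).1 hy
      refine Finset.mem_erase.2 ⟨h4, Finset.mem_powersetCard.2
        ⟨fun a ha => Finset.mem_erase.2 ⟨fun hh => h3 (hh ▸ ha), by simp⟩, by omega⟩⟩
    · have h1 := ((hm.mem_newCorners hlt hd hℓ h hA).1 hy).1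
      have h2 := ((hm.mem_newCorners hlt hd hℓ h hA).1 hz).1
      exact Prod.ext (h1.trans h2.symm) hyz
  refine hle.trans (le_of_eq ?_)
  rw [Finset.card_erase_of_mem hS₁, Finset.card_powersetCard, Finset.card_erase_of_mem (by simp),
    Finset.card_univ, Fintype.card_fin, Nat.add_sub_cancel, Nat.choose_symm (by omega)]
  simp

end IsGluable

end Labelled

end FacetFamily

namespace FacetFamily

open Relation

variable {V : Type*} [DecidableEq V] {d : ℕ} {𝓕 E : Finset (Finset V)} {ι : Type*}
  [Fintype ι] [LinearOrder ι] {ℓ : ι → Fin (d + 1) → V}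

/-- The state is the gluing along the faces of a set `A`, at most `n` interior faces are missing from
`A`, and the queue has a representative of each walk whose ends are to be identified: if two facets
at a missing face `m` are connected around `F` through `A`, then a copy of `F` that is connected
with them is in the queue. -/
def GlueInv (𝓕 E : Finset (Finset V)) (ℓ : ι → Fin (d + 1) → V) (n : ℕ)
    (G : Set (Flag d ι × Flag d ι)) (Q : List (Corner d ι)) : Prop :=
  ∃ A : Finset (Finset V), A ⊆ doors d 𝓕 ∧ E ⊆ A ∧ G = gluing ℓ A ∧ (doors d 𝓕).card ≤ A.card + n ∧
    (∀ x ∈ Q, x.2.card + 1 = d) ∧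
    ∀ m F s t, IsDoor d 𝓕 m s t → F.card + 1 = d → F ⊆ m → m ∉ A →
      ReflTransGen (Cross d 𝓕 A F) s t →
      ∃ y ∈ Q, y.2.image (ℓ y.1) = F ∧ ReflTransGen (Cross d 𝓕 A F) (facet (ℓ y.1)) s

namespace IsConstructible

/-- A question is answered positively if some missing interior face joins two facets that are connected
around the given codimension-two face. -/
theorem glueInv_step (h : IsConstructible d 𝓕 E) (hd : 2 ≤ d) (hℓ : IsFullLabelling 𝓕 ℓ) (n : ℕ)
    (G : Set (Flag d ι × Flag d ι)) (x : Corner d ι) (Q : List (Corner d ι))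
    (hI : GlueInv 𝓕 E ℓ n G (x :: Q)) :
    GlueInv 𝓕 E ℓ n G Q ∨ ∃ n', n = n' + 1 ∧ (glueStep G x).2.length ≤ d - 1 ∧
      GlueInv 𝓕 E ℓ n' (glueStep G x).1 (Q ++ (glueStep G x).2) := by
  obtain ⟨i, S⟩ := x
  obtain ⟨A, hA, hEA, rfl, hn, hQ, hcl⟩ := hI
  have hS : S.card + 1 = d := hQ (i, S) (by simp)
  have hFc : (S.image (ℓ i)).card + 1 = d := by
    rw [Finset.card_image_of_injective _ (hℓ.injective i), hS]
  by_cases hx : ∃ m s t, IsDoor d 𝓕 m s t ∧ S.image (ℓ i) ⊆ m ∧ m ∉ A ∧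
      ReflTransGen (Cross d 𝓕 A (S.image (ℓ i))) s t ∧
      ReflTransGen (Cross d 𝓕 A (S.image (ℓ i))) (facet (ℓ i)) s
  swap
  · refine .inl ⟨A, hA, hEA, rfl, hn, fun x hx => hQ x (by simp [hx]), ?_⟩
    intro m F s t hm hF hFm hmA hst
    obtain ⟨y, hy, hyF, hys⟩ := hcl m F s t hm hF hFm hmA hst
    rcases List.mem_cons.1 hy with rfl | hy
    · subst hyF
      exact absurd ⟨m, s, t, hm, hFm, hmA, hst, hys⟩ hx
    · exact ⟨y, hy, hyF, hys⟩
  right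
  obtain ⟨m, s, t, hm, hFm, hmA, hst, his⟩ := hx
  obtain ⟨i₁, c₁, i₂, c₂, S₁, S₂, hg, hlt⟩ : ∃ i₁ c₁ i₂ c₂ S₁ S₂,
      IsGluable d 𝓕 ℓ A i S m i₁ i₂ c₁ c₂ S₁ S₂ ∧ i₁ < i₂ := by
    obtain ⟨i₁, c₁, i₂, c₂, hne, rfl, rfl, hs1, hs2⟩ := hℓ.exists_sides hm
    obtain ⟨S₁, hS₁⟩ := exists_image_eq (g := ℓ i₁) (hFm.trans hm.2.2.2.2.1)
    obtain ⟨S₂, hS₂⟩ := exists_image_eq (g := ℓ i₂) (hFm.trans hm.2.2.2.2.2)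
    have hg : IsGluable d 𝓕 ℓ A i S m i₁ i₂ c₁ c₂ S₁ S₂ :=
      ⟨hS, hne, hs1, hs2, hS₁, hS₂, hFm, by exact_mod_cast hmA, his, his.trans hst⟩
    rcases lt_or_gt_of_ne hne with hlt | hlt
    · exact ⟨_, _, _, _, _, _, hg, hlt⟩
    · exact ⟨_, _, _, _, _, _, hg.symm, hlt⟩
  clear hst his hm
  have hA' : (A : Set (Finset V)) ⊆ doors d 𝓕 := by exact_mod_cast hA
  have hm := hg.isDoor hℓ
  have hmd : m ∈ doors d 𝓕 := mem_doors.2 ⟨_, _, hm⟩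
  have hinsert : insert m A ⊆ doors d 𝓕 := Finset.insert_subset hmd hA
  have hcard := Finset.card_le_card hinsert
  rw [Finset.card_insert_of_notMem hmA] at hcard
  have hreach : ReflTransGen (Cross d 𝓕 A (S.image (ℓ i))) (facet (ℓ i₁)) (facet (ℓ i₂)) :=
    (reach_symm hg.reach_left).trans hg.reach_right
  refine ⟨n - 1, by omega, ?_, insert m A, hinsert, hEA.trans (Finset.subset_insert _ _), ?_, ?_,
    fun y hy => ?_, ?_⟩
  · rw [glueStep, Finset.length_toList]
    exact hg.card_newCorners_le hlt hd hℓ h hA'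
  · rw [Finset.coe_insert, hg.gluing_insert hd hℓ h hA', glueStep]
  · rw [Finset.card_insert_of_notMem hmA]; omega
  · rcases List.mem_append.1 hy with hy | hy
    · exact hQ y (by simp [hy])
    · rw [glueStep, Finset.mem_toList, hg.mem_newCorners hlt hd hℓ h hA'] at hy
      exact hy.2.1
  · intro m' F s t hm' hF hFm' hm'A hst
    rw [Finset.mem_insert, not_or] at hm'A
    rw [Finset.coe_insert] at hst ⊢
    by_cases hold : ReflTransGen (Cross d 𝓕 A F) s t
    · obtain ⟨y, hy, hyF, hys⟩ := hcl m' F s t hm' hF hFm' hm'A.2 hold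
      rcases List.mem_cons.1 hy with rfl | hy
      · -- The walk around the face in question has only `m` as a free side.
        subst hyF
        exact absurd (h.eq_of_closed_side hFc hm hFm (by exact_mod_cast hmA) hreach
          ((reach_symm hg.reach_left).trans hys) hm'.1 hFm' hm'.2.2.2.2.1
          (by exact_mod_cast hm'A.2)) hm'A.1
      · exact ⟨y, by simp [hy], hyF, reach_mono (Set.subset_insert _ _) hys⟩
    · rcases h.reach_insert hst with hst' | ⟨hFm₁, hst'⟩
      · exact absurd hst' hold
      · have hne : F ≠ S.image (ℓ i) := by
          rintro rfl
          exact hold (h.reach_of_reach_insert hm hreach hst)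
        obtain ⟨T, hT⟩ := exists_image_eq (g := ℓ i₁) (hFm₁.trans hm.2.2.2.2.1)
        refine ⟨(i₁, T), List.mem_append_right _ ?_, hT, hst' _ hm.2.1 hm.2.2.2.2.1⟩
        rw [glueStep, Finset.mem_toList, hg.mem_newCorners hlt hd hℓ h hA']
        refine ⟨rfl, ?_, ?_, ?_⟩
        · rw [← hT, Finset.card_image_of_injective _ (hℓ.injective i₁)] at hF; exact hF
        · rw [← image_subset_side (hℓ.injective i₁), hT, hg.side_left]; exact hFm₁
        · rintro rfl
          exact hne (hT.symm.trans hg.image_left)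

omit [Fintype ι] [LinearOrder ι] in
theorem eq_gluing_of_glueInv (h : IsConstructible d 𝓕 E) {n : ℕ} {G : Set (Flag d ι × Flag d ι)}
    (hI : GlueInv 𝓕 E ℓ n G []) : G = gluing ℓ (doors d 𝓕) := by
  obtain ⟨A, hA, hEA, rfl, -, -, hcl⟩ := hI
  have : A = doors d 𝓕 := by
    refine hA.antisymm fun m hm => ?_
    obtain ⟨s, t, hst⟩ := mem_doors.1 hm
    refine Finset.mem_coe.1
      (h.closure A (by exact_mod_cast hEA) (fun m F s t hm hF hFm hst => ?_) m s t hst)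
    by_contra hmA
    obtain ⟨y, hy, -⟩ := hcl m F s t hm hF hFm (by exact_mod_cast hmA) hst
    simp at hy
  rw [this]

end IsConstructible

/-- Each interior face is a side of two simplices. -/
theorem IsFullLabelling.two_mul_card_le (hℓ : IsFullLabelling 𝓕 ℓ) {A : Finset (Finset V)}
    (hA : A ⊆ doors d 𝓕) :
    2 * A.card ≤ (Finset.univ.filter fun x : ι × Fin (d + 1) => side (ℓ x.1) x.2 ∈ A).card := by
  rw [Finset.card_eq_sum_card_fiberwise (f := fun x : ι × Fin (d + 1) => side (ℓ x.1) x.2) (t := A)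
    (fun x hx => by simpa using hx), mul_comm, ← smul_eq_mul]
  refine Finset.card_nsmul_le_sum _ _ _ fun m hm => ?_
  obtain ⟨s, t, hst⟩ := mem_doors.1 (hA hm)
  obtain ⟨i, c, j, c', hij, -, -, hi, hj⟩ := hℓ.exists_sides hst
  have : ({(i, c), (j, c')} : Finset (ι × Fin (d + 1))).card = 2 :=
    Finset.card_pair fun hh => hij (Prod.mk.inj hh).1
  rw [← this]
  refine Finset.card_le_card fun x hx => ?_
  simp only [Finset.mem_insert, Finset.mem_singleton] at hx
  rcases hx with rfl | rfl <;> simp [hi, hj, hm]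

theorem IsFullLabelling.card_freeCorners_le (hℓ : IsFullLabelling 𝓕 ℓ) (hd : 2 ≤ d)
    {A : Finset (Finset V)} (hA : A ⊆ doors d 𝓕) :
    (freeCorners (gluing ℓ A)).card + d * (2 * A.card) ≤ d * (Fintype.card ι * (d + 1)) := by
  classical
  have h1 : (freeCorners (gluing ℓ A)) ⊆
      (Finset.univ.filter fun x : ι × Fin (d + 1) => side (ℓ x.1) x.2 ∉ A).biUnion fun x =>
        ((Finset.univ.erase x.2).powersetCard (d - 1)).image fun S => (x.1, S) := by
    rintro ⟨i, S⟩ hy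
    simp only [freeCorners, Finset.mem_filter, Finset.mem_univ, true_and] at hy
    obtain ⟨hS, c, hc, hG⟩ := hy
    rw [hℓ.isGlued_iff hd (by exact_mod_cast hA)] at hG
    refine Finset.mem_biUnion.2 ⟨(i, c), by simpa using hG, Finset.mem_image_of_mem _ ?_⟩
    exact Finset.mem_powersetCard.2
      ⟨fun a ha => Finset.mem_erase.2 ⟨fun hh : a = c => hc (hh ▸ ha), by simp⟩, by omega⟩
  have h2 := (Finset.card_le_card h1).trans (Finset.card_biUnion_le_card_mul _ _ d fun x _ => by
    refine Finset.card_image_le.trans (le_of_eq ?_)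
    rw [Finset.card_powersetCard, Finset.card_erase_of_mem (by simp), Finset.card_univ,
      Fintype.card_fin, Nat.add_sub_cancel, Nat.choose_symm (by omega)]
    simp)
  have h3 := hℓ.two_mul_card_le hA
  have h4 := Finset.card_filter_add_card_filter_not (s := (Finset.univ : Finset (ι × Fin (d + 1))))
    (fun x => side (ℓ x.1) x.2 ∈ A)
  rw [Finset.card_univ, Fintype.card_prod, Fintype.card_fin] at h4
  rw [← h4]
  nlinarith

omit [LinearOrder ι] in
theorem IsFullLabelling.card_eq (hℓ : IsFullLabelling 𝓕 ℓ) : Fintype.card ι = 𝓕.card := by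
  rw [← Finset.card_univ, ← Finset.card_image_of_injective Finset.univ
    (f := fun i => facet (ℓ i)) fun i j hij => hℓ.eq_of_facet_eq i j hij]
  congr 1
  ext f
  simp only [Finset.mem_image, Finset.mem_univ, true_and]
  exact ⟨fun ⟨i, hi⟩ => hi ▸ hℓ.facet_mem i, hℓ.exists_facet f⟩

/-- The identifications are given by a code, once the tree is known. -/
theorem IsConstructible.exists_glue_code (h : IsConstructible d 𝓕 E) (hd : 2 ≤ d)
    (hℓ : IsFullLabelling 𝓕 ℓ) (hE : E ⊆ doors d 𝓕) (hcard : E.card + 1 = 𝓕.card) :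
    ∃ bs ∈ QueueProcess.codes
      (d * ((d - 1) * 𝓕.card + 2) + (d - 1) * (((d - 1) * 𝓕.card + 2) / 2))
      (((d - 1) * 𝓕.card + 2) / 2),
      QueueProcess.run glueStep (gluing ℓ E) (freeCorners (gluing ℓ E)).toList bs =
        gluing ℓ (doors d 𝓕) := by
  have hι := hℓ.card_eq
  obtain ⟨e, rfl⟩ := Nat.exists_eq_add_of_le' (show 1 ≤ d by omega)
  rw [Nat.add_sub_cancel]
  have h1 := hℓ.card_freeCorners_le hd hE
  have h2 : 2 * (doors (e + 1) 𝓕).card ≤ 𝓕.card * (e + 1 + 1) := by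
    refine (hℓ.two_mul_card_le subset_rfl).trans ((Finset.card_le_univ _).trans (le_of_eq ?_))
    rw [Fintype.card_prod, Fintype.card_fin, hι]
  set X := e * 𝓕.card + 2 with hX
  have hI : GlueInv 𝓕 E ℓ (X / 2) (gluing ℓ E) (freeCorners (gluing ℓ E)).toList := by
    refine ⟨E, hE, subset_rfl, rfl, ?_, fun x hx => ?_, ?_⟩
    · have : 2 * (doors (e + 1) 𝓕).card ≤ 2 * E.card + X := by
        rw [hX]; rw [← hcard] at h2 ⊢; nlinarith
      omega
    · simp only [freeCorners, Finset.mem_toList, Finset.mem_filter] at hx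
      exact hx.2.1
    · intro m F s t hm hF hFm hmE hst
      obtain ⟨i, c, -, -, -, rfl, -, rfl, -⟩ := hℓ.exists_sides hm
      obtain ⟨S, rfl⟩ := exists_image_eq (hFm.trans (side_subset_facet _ _))
      refine ⟨(i, S), ?_, rfl, .refl⟩
      simp only [freeCorners, Finset.mem_toList, Finset.mem_filter, Finset.mem_univ, true_and]
      refine ⟨?_, c, (image_subset_side (hℓ.injective i)).1 hFm, ?_⟩
      · rwa [Finset.card_image_of_injective _ (hℓ.injective i)] at hF
      · rw [hℓ.isGlued_iff hd (by exact_mod_cast hE)]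
        exact_mod_cast hmE
  obtain ⟨bs, hbs, n, hn⟩ := QueueProcess.exists_code glueStep e (GlueInv 𝓕 E ℓ)
    (h.glueInv_step hd hℓ) ((e + 1) * X + e * (X / 2)) (X / 2) _ _ (by
      rw [Finset.length_toList]
      have : (freeCorners (gluing ℓ E)).card ≤ (e + 1) * X := by
        rw [hι] at h1
        have : (e + 1) * (𝓕.card * (e + 1 + 1)) = (e + 1) * (2 * E.card) + (e + 1) * X := by
          rw [hX, ← hcard]; ring
        omega
      omega) hI
  exact ⟨bs, hbs, h.eq_gluing_of_glueInv hn⟩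

/-- The gluing of `N` simplices that is given by a tree. -/
def treeGluing (N : ℕ) (out : List (ℕ × Fin (d + 1))) : Set (Flag d (Fin N) × Flag d (Fin N)) :=
  {p | p.1.2 = p.2.2 ∧ p.1.2.2 ≠ p.1.2.1 ∧
    ∃ r : ℕ, (out[r]? = some ((p.1.1 : ℕ), p.1.2.1) ∧ (p.2.1 : ℕ) = r + 1) ∨
      (out[r]? = some ((p.2.1 : ℕ), p.1.2.1) ∧ (p.1.1 : ℕ) = r + 1)}

namespace IsLabelling

variable {out : List (ℕ × Fin (d + 1))} {l : ℕ → Fin (d + 1) → V}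

theorem isFullLabelling (hl : IsLabelling 𝓕 E out l) :
    IsFullLabelling 𝓕 (fun i : Fin 𝓕.card => l i) where
  injective i := hl.injective i (by have := hl.card; omega)
  facet_mem i := hl.facet_mem i (by have := hl.card; omega)
  eq_of_facet_eq i j hij := by
    have := hl.card
    exact Fin.ext (hl.eq_of_facet_eq i (by omega) j (by omega) hij)
  exists_facet f hf := by
    obtain ⟨i, hi, rfl⟩ := hl.exists_facet f hf
    exact ⟨⟨i, by have := hl.card; omega⟩, rfl⟩

theorem length_lt {r : ℕ} {x : ℕ × Fin (d + 1)} (hl : IsLabelling 𝓕 E out l) (hr : out[r]? = some x) :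
    r + 1 < 𝓕.card := by
  have := hl.card
  have := (List.getElem?_eq_some_iff.1 hr).1
  omega

theorem side_succ (hl : IsLabelling 𝓕 E out l) {r i : ℕ} {c : Fin (d + 1)}
    (hr : out[r]? = some (i, c)) : side (l (r + 1)) c = side (l i) c :=
  side_congr (hl.tree r i c hr).2.1

theorem subset_doors (hl : IsLabelling 𝓕 E out l) : E ⊆ doors d 𝓕 := by
  intro m hm
  obtain ⟨r, i, c, hr, rfl⟩ := hl.exists_side m hm
  have h1 := hl.length_lt hr
  have h2 := (hl.tree r i c hr).1
  have := hl.isFullLabelling.isDoor_of_side_eq (i := ⟨i, by omega⟩) (j := ⟨r + 1, h1⟩)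
    (c := c) (c' := c)
    (fun hh => by have := congrArg Fin.val hh; dsimp only at this; omega) (hl.side_succ hr).symm
  exact mem_doors.2 ⟨_, _, this⟩

theorem gluing_eq (hl : IsLabelling 𝓕 E out l) (h : IsConstructible d 𝓕 E) :
    gluing (fun i : Fin 𝓕.card => l i) (E : Set (Finset V)) = treeGluing 𝓕.card out := by
  have hℓ := hl.isFullLabelling
  ext ⟨⟨i, c, a⟩, j, c', b⟩
  constructor
  · rintro ⟨hij, ha, hb, hs, hE, hab⟩
    dsimp only at *
    obtain ⟨r, k, c₀, hr, hk⟩ := hl.exists_side _ (Finset.mem_coe.1 hE)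
    have h1 := hl.length_lt hr
    have h2 := (hl.tree r k c₀ hr).1
    have hk' := (hl.side_succ hr).trans hk
    have hdoor := hℓ.isDoor_of_side_eq hij hs
    have hik := h.eq_or_eq_of_isDoor hdoor (hl.facet_mem k (by have := hl.card; omega))
      (hk ▸ side_subset_facet _ _)
    have hir := h.eq_or_eq_of_isDoor hdoor (hl.facet_mem (r + 1) (by have := hl.card; omega))
      (hk' ▸ side_subset_facet _ _)
    have hval : ∀ (u v : ℕ), u < 𝓕.card → v < 𝓕.card → facet (l u) = facet (l v) → u = v :=
      fun u v hu hv huv => hl.eq_of_facet_eq u (by have := hl.card; omega) v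
        (by have := hl.card; omega) huv
    rcases hik with hik | hik <;> rcases hir with hir | hir <;>
      replace hik := hval _ _ (by omega) (by omega) hik <;>
      replace hir := hval _ _ (by omega) (by omega) hir
    · omega
    · subst hik
      rw [hir] at hk'
      obtain rfl := side_injective (hℓ.injective i) hk
      obtain rfl : c₀ = c' := side_injective (hℓ.injective j) (hk'.trans hs)
      have hlab := (hl.tree r i c₀ hr).2.1 a ha
      rw [hir] at hlab
      obtain rfl : a = b := hℓ.injective j (hlab.trans hab)
      exact ⟨rfl, ha, r, .inl ⟨hr, hir.symm⟩⟩
    · subst hik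
      rw [hir] at hk'
      obtain rfl := side_injective (hℓ.injective i) hk'
      obtain rfl : c₀ = c' := side_injective (hℓ.injective j) (hk.trans hs)
      have hlab := (hl.tree r j c₀ hr).2.1 a ha
      rw [hir] at hlab
      obtain rfl : a = b := hℓ.injective j (hlab.symm.trans hab)
      exact ⟨rfl, ha, r, .inr ⟨hr, hir.symm⟩⟩
    · omega
  · rintro ⟨heq, ha, r, ⟨hr, hj⟩ | ⟨hr, hj⟩⟩ <;> dsimp only at * <;>
      obtain ⟨rfl, rfl⟩ := Prod.mk.inj heq <;>
      obtain ⟨h1, h2, h3⟩ := hl.tree r _ c hr <;> have hs := hl.side_succ hr <;> rw [← hj] at h2 hs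
    · exact ⟨fun hh => by dsimp only at hh; subst hh; omega, ha, ha, hs.symm, h3, (h2 a ha).symm⟩
    · exact ⟨fun hh => by dsimp only at hh; subst hh; omega, ha, ha, hs,
        by dsimp only; rw [hs]; exact h3, h2 a ha⟩

end IsLabelling

/-- The gluing of `N` simplices that is given by a pair of codes. -/
noncomputable def decode (d N : ℕ) (b : List Bool × List Bool) :
    Set (Flag d (Fin N) × Flag d (Fin N)) :=
  let G := treeGluing N (QueueProcess.run (growTree d) [] (Finset.univ.toList.map fun c => (0, c)) b.1)
  QueueProcess.run glueStep G (freeCorners G).toList b.2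

/-- The pairs of codes for the complexes with `N` facets. -/
noncomputable def codePairs (d N : ℕ) : Finset (List Bool × List Bool) :=
  QueueProcess.codes (d * N + 1) (N - 1) ×ˢ QueueProcess.codes
    (d * ((d - 1) * N + 2) + (d - 1) * (((d - 1) * N + 2) / 2)) (((d - 1) * N + 2) / 2)

theorem IsConstructible.exists_code (h : IsConstructible d 𝓕 E) (hd : 2 ≤ d) {N : ℕ}
    (hN : 𝓕.card = N) :
    ∃ b ∈ codePairs d N, ∃ ℓ : Fin N → Fin (d + 1) → V, IsFullLabelling 𝓕 ℓ ∧
      decode d N b = gluing ℓ (doors d 𝓕) := by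
  subst hN
  obtain ⟨b₁, hb₁, l, hl⟩ := h.exists_tree_code
  obtain ⟨b₂, hb₂, hG⟩ := h.exists_glue_code hd hl.isFullLabelling hl.subset_doors hl.card_edges
  refine ⟨(b₁, b₂), Finset.mem_product.2 ⟨hb₁, hb₂⟩, _, hl.isFullLabelling, ?_⟩
  rw [hl.gluing_eq h] at hG
  exact hG

omit [Fintype ι] [LinearOrder ι] in
/-- Since the facets at a vertex are connected through interior faces at this vertex, all coincidences
of labelled vertices are consequences of the gluings. -/
theorem IsConstructible.eq_iff_eqvGen (h : IsConstructible d 𝓕 E) (hℓ : IsFullLabelling 𝓕 ℓ)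
    {u v : ι × Fin (d + 1)} :
    ℓ u.1 u.2 = ℓ v.1 v.2 ↔ EqvGen (VertexStep (gluing ℓ (doors d 𝓕))) u v := by
  refine ⟨fun huv => ?_, eq_of_eqvGen⟩
  obtain ⟨i, a⟩ := u
  obtain ⟨j, b⟩ := v
  dsimp only at huv
  have hmem : ∀ k e, ℓ k e ∈ facet (ℓ k) := fun k e => Finset.mem_image_of_mem _ (Finset.mem_univ e)
  have hr := h.star (ℓ i a) _ (hℓ.facet_mem i) _ (hℓ.facet_mem j) (hmem i a) (huv ▸ hmem j b)
  generalize hg : facet (ℓ j) = g at hr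
  induction hr generalizing j b with
  | refl =>
    obtain rfl := hℓ.eq_of_facet_eq _ _ hg
    obtain rfl := hℓ.injective _ huv
    exact .refl _
  | tail hpre hc ih =>
    subst hg
    obtain ⟨hk, hj, hne, m, -, hmc, hvm, hmk, hmj⟩ := hc
    obtain ⟨k, rfl⟩ := hℓ.exists_facet _ hk
    obtain ⟨c, rfl⟩ := exists_eq_side (hℓ.injective k) hmc hmk
    obtain ⟨c', hc'⟩ := exists_eq_side (hℓ.injective j) hmc hmj
    have hkj : k ≠ j := fun hh => hne (by rw [hh])
    have hv := hvm (Finset.mem_singleton_self _)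
    obtain ⟨e, he, hea⟩ := Finset.mem_image.1 hv
    refine .trans _ _ _ (ih k e hea.symm rfl) (.rel _ _ ⟨c, c', hkj, Finset.ne_of_mem_erase he, ?_, hc',
      Finset.mem_coe.2 (mem_doors.2 ⟨_, _, hℓ.isDoor_of_side_eq hkj hc'⟩), hea.trans huv⟩)
    rw [hc', huv] at hv
    exact (mem_side (hℓ.injective j)).1 hv

omit [Fintype ι] [LinearOrder ι] in
/-- Two families of facets with the same gluing are isomorphic. -/
theorem IsConstructible.exists_equiv {W : Type*} [DecidableEq W] {𝓕' E' : Finset (Finset W)}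
    {ℓ' : ι → Fin (d + 1) → W} (h : IsConstructible d 𝓕 E) (h' : IsConstructible d 𝓕' E')
    (hℓ : IsFullLabelling 𝓕 ℓ) (hℓ' : IsFullLabelling 𝓕' ℓ')
    (hV : ∀ v, ∃ f ∈ 𝓕, v ∈ f) (hW : ∀ w, ∃ f ∈ 𝓕', w ∈ f)
    (hG : gluing ℓ (doors d 𝓕) = gluing ℓ' (doors d 𝓕')) :
    ∃ e : V ≃ W, ∀ i, (facet (ℓ i)).map e.toEmbedding = facet (ℓ' i) := by
  have hsurj : ∀ v, ∃ u : ι × Fin (d + 1), ℓ u.1 u.2 = v := by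
    intro v
    obtain ⟨f, hf, hv⟩ := hV v
    obtain ⟨i, rfl⟩ := hℓ.exists_facet f hf
    obtain ⟨a, -, rfl⟩ := Finset.mem_image.1 hv
    exact ⟨(i, a), rfl⟩
  have hsurj' : ∀ v, ∃ u : ι × Fin (d + 1), ℓ' u.1 u.2 = v := by
    intro v
    obtain ⟨f, hf, hv⟩ := hW v
    obtain ⟨i, rfl⟩ := hℓ'.exists_facet f hf
    obtain ⟨a, -, rfl⟩ := Finset.mem_image.1 hv
    exact ⟨(i, a), rfl⟩
  have hker : ∀ u v : ι × Fin (d + 1), ℓ u.1 u.2 = ℓ v.1 v.2 ↔ ℓ' u.1 u.2 = ℓ' v.1 v.2 := by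
    intro u v
    rw [h.eq_iff_eqvGen hℓ, h'.eq_iff_eqvGen hℓ', hG]
  choose p hp using hsurj
  choose p' hp' using hsurj'
  let e : V ≃ W :=
    { toFun := fun v => ℓ' (p v).1 (p v).2
      invFun := fun w => ℓ (p' w).1 (p' w).2
      left_inv := fun v => by
        conv_rhs => rw [← hp v]
        exact (hker _ _).2 (hp' _)
      right_inv := fun w => by
        conv_rhs => rw [← hp' w]
        exact (hker _ _).1 (hp _) }
  have he : ∀ i a, e (ℓ i a) = ℓ' i a := fun i a => (hker (p (ℓ i a)) (i, a)).1 (hp _)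
  refine ⟨e, fun i => ?_⟩
  rw [Finset.map_eq_image, facet, facet, Finset.image_image]
  exact Finset.image_congr fun a _ => he i a

end FacetFamily

/-! ### Face posets of simplicial regular CW complexes -/

section IsSimplex

variable {P Q : Type*} [PartialOrder P] [PartialOrder Q]

theorem IsSimplex.card_Iic {m : ℕ} {x : P} (h : IsSimplex m x) : Nat.card (Set.Iic x) = 2 ^ m := by
  obtain ⟨e⟩ := h
  rw [Nat.card_congr e.toEquiv]
  simp

theorem IsSimplex.dim_unique {m n : ℕ} {x : P} (hm : IsSimplex m x) (hn : IsSimplex n x) : m = n :=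
  Nat.pow_right_injective le_rfl (hm.card_Iic.symm.trans hn.card_Iic)

theorem IsSimplex.of_orderIso {m : ℕ} {x : P} {y : Q} (h : IsSimplex m x)
    (e : Set.Iic x ≃o Set.Iic y) : IsSimplex m y :=
  h.map e.symm.trans

theorem card_Iic_lt [Finite P] {x y : P} (h : x < y) : Nat.card (Set.Iic x) < Nat.card (Set.Iic y) := by
  rw [Nat.card_coe_set_eq, Nat.card_coe_set_eq]
  exact Set.ncard_lt_ncard (Set.Iic_ssubset_Iic.2 h) (Set.toFinite _)

theorem IsSimplex.eq_of_le [Finite P] {m : ℕ} {x y : P} (hx : IsSimplex m x) (hy : IsSimplex m y)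
    (h : x ≤ y) : x = y := by
  by_contra hne
  exact (card_Iic_lt (lt_of_le_of_ne h hne)).ne (hx.card_Iic.trans hy.card_Iic.symm)

theorem IsSimplex.not_le [Finite P] {m : ℕ} {x y : P} (hx : IsSimplex (m + 1) x) (hy : IsSimplex m y) :
    ¬ x ≤ y := by
  intro h
  have h1 : Nat.card (Set.Iic x) ≤ Nat.card (Set.Iic y) := by
    rw [Nat.card_coe_set_eq, Nat.card_coe_set_eq]
    exact Set.ncard_le_ncard (Set.Iic_subset_Iic.2 h) (Set.toFinite _)
  rw [hx.card_Iic, hy.card_Iic] at h1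
  exact absurd h1 (_root_.not_le.2 (Nat.pow_lt_pow_right (by norm_num) (Nat.lt_succ_self m)))

theorem nonempty_orderIso_Iic (f : P → Q) {x : P} {y : Q} (hmem : ∀ a ≤ x, f a ≤ y)
    (hle : ∀ a ≤ x, ∀ b ≤ x, f a ≤ f b ↔ a ≤ b) (hsurj : ∀ b ≤ y, ∃ a ≤ x, f a = b) :
    Nonempty (Set.Iic x ≃o Set.Iic y) := by
  let g : Set.Iic x ↪o Set.Iic y :=
    OrderEmbedding.ofMapLEIff (fun a => ⟨f a, hmem a a.2⟩) fun a b => hle a a.2 b b.2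
  refine ⟨RelIso.ofSurjective g fun b => ?_⟩
  obtain ⟨a, ha, hab⟩ := hsurj b b.2
  exact ⟨⟨a, ha⟩, Subtype.ext hab⟩

theorem isSimplex_iff_of_isLowerSet {j : P ↪o Q} (hj : IsLowerSet (Set.range j)) {m : ℕ} {x : P} :
    IsSimplex m (j x) ↔ IsSimplex m x := by
  obtain ⟨e⟩ : Nonempty (Set.Iic x ≃o Set.Iic (j x)) :=
    nonempty_orderIso_Iic j (fun a ha => j.monotone ha) (fun a _ b _ => j.le_iff_le) fun b hb => by
      obtain ⟨a, rfl⟩ := hj hb ⟨x, rfl⟩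
      exact ⟨a, j.le_iff_le.1 hb, rfl⟩
  exact ⟨fun h => h.of_orderIso e.symm, fun h => h.of_orderIso e⟩

theorem strictMono_card_le {m n : ℕ} (f : Finset (Fin m) → Finset (Fin n)) (hf : StrictMono f) :
    m ≤ n := by
  have h : ∀ s, s.card ≤ (f s).card := by
    intro s
    induction s using Finset.induction_on with
    | empty => simp
    | insert a s ha ih =>
      rw [Finset.card_insert_of_notMem ha]
      exact lt_of_le_of_lt ih (Finset.card_lt_card (hf (Finset.ssubset_insert ha)))
  simpa using (h Finset.univ).trans (Finset.card_le_univ _)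

end IsSimplex

namespace SimplicialCW

open Relation

section Certificate

/-- The `d`-cells `a` and `b` are adjacent through a `(d-1)`-cell that belongs to `A` and
contains `x`. -/
def Cross {P : Type*} [PartialOrder P] (d : ℕ) (A : Set P) (x a b : P) : Prop :=
  IsSimplex (d + 1) a ∧ IsSimplex (d + 1) b ∧ a ≠ b ∧ ∃ m ∈ A, IsSimplex d m ∧ x ≤ m ∧ m ≤ a ∧ m ≤ b

/-- `m` is an interior `(d-1)`-cell between the `d`-cells `s` and `t`. -/
def IsDoor {P : Type*} [PartialOrder P] (d : ℕ) (m s t : P) : Prop :=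
  IsSimplex d m ∧ IsSimplex (d + 1) s ∧ IsSimplex (d + 1) t ∧ s ≠ t ∧ m ≤ s ∧ m ≤ t

/-- The properties that are kept by the steps of a local construction: `E` is the set of the cells along
which simplices have been attached, there are at most `n` of these, and all other interior
`(d-1)`-cells result from identifications of adjacent cells. -/
structure IsConstructible (d n : ℕ) (P : SimplicialCW) (E : Set P.Cell) : Prop where
  star : ∀ x s t : P.Cell, IsSimplex (d + 1) s → IsSimplex (d + 1) t → x ≤ s → x ≤ t →
    ReflTransGen (Cross d Set.univ x) s t
  connected : ∀ s t : P.Cell, IsSimplex (d + 1) s → IsSimplex (d + 1) t →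
    ReflTransGen (Cross d E ⊥) s t
  card_tree : E.ncard ≤ n
  closure : ∀ A : Set P.Cell, E ⊆ A →
    (∀ m F s t, IsDoor d m s t → IsSimplex (d - 1) F → F ≤ m → ReflTransGen (Cross d A F) s t → m ∈ A) →
    ∀ m s t, IsDoor d m s t → m ∈ A

variable {P Q : Type*} [PartialOrder P] [PartialOrder Q] {d : ℕ}

theorem Cross.symm {A : Set P} {x a b : P} (h : Cross d A x a b) : Cross d A x b a := by
  obtain ⟨ha, hb, hab, m, hm, hd, hF, hma, hmb⟩ := h
  exact ⟨hb, ha, hab.symm, m, hm, hd, hF, hmb, hma⟩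

theorem reach_symm {A : Set P} {x a b : P} (h : ReflTransGen (Cross d A x) a b) :
    ReflTransGen (Cross d A x) b a := by
  induction h with
  | refl => exact .refl
  | tail _ hc ih => exact .head hc.symm ih

theorem reach_map {f : P → Q} (hf : Monotone f) (hs : ∀ k x, IsSimplex k x → IsSimplex k (f x))
    (hinj : ∀ a b, IsSimplex (d + 1) a → IsSimplex (d + 1) b → f a = f b → a = b)
    {A : Set P} {B : Set Q} {x : P} {y : Q}
    (hAB : ∀ m s t, IsDoor d m s t → m ∈ A → f m ∈ B) (hxy : y ≤ f x) {a b : P}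
    (h : ReflTransGen (Cross d A x) a b) : ReflTransGen (Cross d B y) (f a) (f b) := by
  refine ReflTransGen.lift f (fun a b hab => ?_) _ _ h
  obtain ⟨ha, hb, hab, m, hm, hd, hF, hma, hmb⟩ := hab
  exact ⟨hs _ _ ha, hs _ _ hb, fun h => hab (hinj a b ha hb h), f m,
    hAB m a b ⟨hd, ha, hb, hab, hma, hmb⟩ hm, hs _ _ hd, hxy.trans (hf hF), hf hma, hf hmb⟩

end Certificate

theorem isConstructible_simplex {d : ℕ} {P : SimplicialCW} (e : P.Cell ≃o Finset (Fin (d + 1))) :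
    IsConstructible d 0 P ∅ := by
  have htop : IsSimplex (d + 1) (e.symm Finset.univ) :=
    (nonempty_orderIso_Iic e (fun a _ => Finset.subset_univ _) (fun a _ b _ => e.le_iff_le)
      fun b _ => ⟨e.symm b, e.symm.monotone (Finset.subset_univ _), by simp⟩ :
      Nonempty (Set.Iic _ ≃o Set.Iic (Finset.univ : Finset (Fin (d + 1))))).elim fun e' =>
        ⟨e'.trans ((OrderIso.setCongr _ _ (by ext; simp)).trans OrderIso.Set.univ)⟩
  have huniq : ∀ s, IsSimplex (d + 1) s → s = e.symm Finset.univ := fun s hs =>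
    hs.eq_of_le htop ((e.le_symm_apply).2 (Finset.subset_univ _))
  have huniq2 : ∀ s t : P.Cell, IsSimplex (d + 1) s → IsSimplex (d + 1) t → s = t :=
    fun s t hs ht => (huniq s hs).trans (huniq t ht).symm
  refine ⟨fun x s t hs ht _ _ => ?_, fun s t hs ht => ?_, by simp, fun A _ _ m s t hm => ?_⟩
  · rw [huniq2 s t hs ht]
  · rw [huniq2 s t hs ht]
  · exact absurd (huniq2 s t hm.2.1 hm.2.2.1) hm.2.2.2.1

/-- A boundary cell lies in a unique `d`-cell. -/
theorem exists_cofacet {d : ℕ} {P : SimplicialCW} {σ : P.Cell} (h : P.IsBoundaryCell d σ) :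
    ∃ s, IsSimplex (d + 1) s ∧ σ ≤ s ∧ ∀ t, IsSimplex (d + 1) t → σ ≤ t → t = s := by
  obtain ⟨s, hs⟩ := Set.ncard_eq_one.1 h.2
  have hmem : ∀ t, (IsSimplex (d + 1) t ∧ σ ≤ t) ↔ t = s := fun t => by
    rw [← Set.mem_singleton_iff, ← hs]; rfl
  exact ⟨s, ((hmem s).2 rfl).1, ((hmem s).2 rfl).2, fun t ht hσ => (hmem t).1 ⟨ht, hσ⟩⟩

/-- Attaching a simplex `t` along `σ` adds the cell `σ` to the tree; it is the only new interior cell, and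
the star of each face of `σ` is extended by `t` through `σ`. -/
theorem IsConstructible.gluesSimplex {d n : ℕ} {P Q : SimplicialCW} {E : Set P.Cell}
    (h : IsConstructible d n P E) (hPQ : P.GluesSimplex d Q) :
    ∃ E', IsConstructible d (n + 1) Q E' := by
  obtain ⟨j, σ, t, hσ, ht, hj, hcov, hmeet⟩ := hPQ
  obtain ⟨s₀, hs₀, hσs₀, -⟩ := exists_cofacet hσ
  have hdim : ∀ k x, IsSimplex k (j x) ↔ IsSimplex k x := fun k x => isSimplex_iff_of_isLowerSet hj
  have hσt : j σ ≤ t := ((hmeet (j σ)).2 le_rfl).2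
  have hjσ : IsSimplex d (j σ) := (hdim _ _).2 hσ.1
  have htj : t ∉ Set.range j := fun hh => ht.not_le hjσ ((hmeet t).1 ⟨hh, le_rfl⟩)
  have hcell : ∀ y, IsSimplex (d + 1) y → (∃ s, IsSimplex (d + 1) s ∧ j s = y) ∨ y = t := by
    intro y hy
    rcases hcov y with ⟨s, rfl⟩ | hyt
    · exact .inl ⟨s, (hdim _ _).1 hy, rfl⟩
    · exact .inr (hy.eq_of_le ht hyt)
  have hmap : ∀ {A : Set P.Cell} {B : Set Q.Cell} {x : P.Cell} {y : Q.Cell} {a b : P.Cell},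
      (∀ m s t, IsDoor d m s t → m ∈ A → j m ∈ B) → y ≤ j x →
      ReflTransGen (Cross d A x) a b → ReflTransGen (Cross d B y) (j a) (j b) :=
    fun hAB hxy hab => reach_map j.monotone (fun k x => (hdim k x).2)
      (fun a b _ _ hab => j.injective hab) hAB hxy hab
  have hcross : ∀ {B : Set Q.Cell} {y : Q.Cell}, j σ ∈ B → y ≤ j σ → Cross d B y (j s₀) t :=
    fun hB hy => ⟨(hdim _ _).2 hs₀, ht, fun hh => htj ⟨_, hh⟩, j σ, hB, hjσ, hy, j.monotone hσs₀, hσt⟩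
  have hstar : ∀ (x' : Q.Cell) (s : P.Cell), IsSimplex (d + 1) s → x' ≤ j s → x' ≤ t →
      ReflTransGen (Cross d Set.univ x') (j s) t := by
    intro x' s hs hxs hxt
    obtain ⟨x, rfl⟩ := hj hxs ⟨s, rfl⟩
    have hxσ := (hmeet (j x)).1 ⟨⟨x, rfl⟩, hxt⟩
    exact (hmap (by simp) le_rfl (h.star x s s₀ hs hs₀ (j.le_iff_le.1 hxs)
      ((j.le_iff_le.1 hxσ).trans hσs₀))).tail (hcross trivial hxσ)
  have hconn : ∀ s : P.Cell, IsSimplex (d + 1) s →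
      ReflTransGen (Cross d (insert (j σ) (j '' E)) ⊥) (j s) t := fun s hs =>
    (hmap (fun m _ _ _ hm => .inr ⟨m, hm, rfl⟩) bot_le (h.connected s s₀ hs hs₀)).tail
      (hcross (.inl rfl) bot_le)
  refine ⟨insert (j σ) (j '' E), fun x' s' t' hs' ht' hxs hxt => ?_, fun s' t' hs' ht' => ?_, ?_,
    fun A hA hcl m s' t' hm => ?_⟩
  · rcases hcell s' hs' with ⟨s, hs, rfl⟩ | rfl <;> rcases hcell t' ht' with ⟨r, hr, rfl⟩ | rfl
    · obtain ⟨x, rfl⟩ := hj hxs ⟨s, rfl⟩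
      exact hmap (by simp) le_rfl (h.star x s r hs hr (j.le_iff_le.1 hxs) (j.le_iff_le.1 hxt))
    · exact hstar x' s hs hxs hxt
    · exact reach_symm (hstar x' r hr hxt hxs)
    · exact .refl
  · rcases hcell s' hs' with ⟨s, hs, rfl⟩ | rfl <;> rcases hcell t' ht' with ⟨r, hr, rfl⟩ | rfl
    · exact hmap (fun m _ _ _ hm => .inr ⟨m, hm, rfl⟩) bot_le (h.connected s r hs hr)
    · exact hconn s hs
    · exact reach_symm (hconn r hr)
    · exact .refl
  · refine (Set.ncard_insert_le _ _).trans ?_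
    have := Set.ncard_image_le (f := j) (Set.toFinite E)
    have := h.card_tree
    omega
  · have hold : ∀ m s t, IsDoor d m s t → j m ∈ A := by
      refine h.closure (j ⁻¹' A) (fun m hm => hA (.inr ⟨m, hm, rfl⟩)) fun m F s t hm hF hFm hst => ?_
      refine hcl (j m) (j F) (j s) (j t) ⟨(hdim _ _).2 hm.1, (hdim _ _).2 hm.2.1, (hdim _ _).2 hm.2.2.1,
        fun hh => hm.2.2.2.1 (j.injective hh), j.monotone hm.2.2.2.2.1, j.monotone hm.2.2.2.2.2⟩
        ((hdim _ _).2 hF) (j.monotone hFm) (hmap (fun _ _ _ _ h => h) le_rfl hst)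
    obtain ⟨hmd, hs', ht', hne, hms, hmt⟩ := hm
    have hnew : ∀ s : P.Cell, m ≤ j s → m ≤ t → m ∈ A := by
      intro s hms hmt
      have hmr := hj hms ⟨s, rfl⟩
      rw [hmd.eq_of_le hjσ ((hmeet m).1 ⟨hmr, hmt⟩)]
      exact hA (.inl rfl)
    rcases hcell s' hs' with ⟨s, hs, rfl⟩ | rfl <;> rcases hcell t' ht' with ⟨r, hr, rfl⟩ | rfl
    · obtain ⟨m, rfl⟩ := hj hms ⟨s, rfl⟩
      exact hold m s r ⟨(hdim _ _).1 hmd, hs, hr, fun hh => hne (by rw [hh]), j.le_iff_le.1 hms,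
        j.le_iff_le.1 hmt⟩
    · exact hnew s hms hmt
    · exact hnew r hmt hms
    · exact absurd rfl hne

end SimplicialCW

/-! ### Identifications of boundary cells -/

namespace SimplicialCW

open Relation

/-- One direction of the identification of the closed cell `σ` with the closed cell `τ`. -/
def Identified {P : SimplicialCW} {σ τ : P.Cell} (φ : Set.Iic σ ≃o Set.Iic τ) (a b : P.Cell) : Prop :=
  ∃ h : a ≤ σ, (φ ⟨a, h⟩).1 = b

section Identified

variable {P : SimplicialCW} {σ τ : P.Cell} {φ : Set.Iic σ ≃o Set.Iic τ}

theorem Identified.nonempty_orderIso {a b : P.Cell} (h : Identified φ a b) :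
    Nonempty (Set.Iic a ≃o Set.Iic b) := by
  obtain ⟨ha, rfl⟩ := h
  let e : Set.Iic a ↪o Set.Iic (φ ⟨a, ha⟩).1 :=
    OrderEmbedding.ofMapLEIff (fun x => ⟨(φ ⟨x, le_trans x.2 ha⟩).1, φ.monotone x.2⟩) fun x y =>
      φ.le_iff_le (x := ⟨x, le_trans x.2 ha⟩) (y := ⟨y, le_trans y.2 ha⟩)
  refine ⟨RelIso.ofSurjective e fun y => ?_⟩
  have hy : y.1 ≤ τ := le_trans y.2 (φ ⟨a, ha⟩).2
  have hle : (φ.symm ⟨y, hy⟩).1 ≤ a := (φ.symm_apply_le (x := ⟨a, ha⟩)).2 y.2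
  refine ⟨⟨_, hle⟩, Subtype.ext ?_⟩
  exact congrArg (fun z : Set.Iic τ => z.1) (φ.apply_symm_apply ⟨y.1, hy⟩)

theorem card_Iic_eq_of_eqvGen {a b : P.Cell} (h : EqvGen (Identified φ) a b) :
    Nat.card (Set.Iic a) = Nat.card (Set.Iic b) := by
  induction h with
  | rel _ _ h => exact h.nonempty_orderIso.elim fun e => Nat.card_congr e.toEquiv
  | refl => rfl
  | symm _ _ _ ih => exact ih.symm
  | trans _ _ _ _ _ ih1 ih2 => exact ih1.trans ih2

/-- Identified cells have the same faces up to identification. -/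
theorem exists_le_of_eqvGen {a b : P.Cell} (h : EqvGen (Identified φ) a b) :
    (∀ y ≤ b, ∃ x ≤ a, EqvGen (Identified φ) x y) ∧ (∀ x ≤ a, ∃ y ≤ b, EqvGen (Identified φ) x y) := by
  induction h with
  | rel a b h =>
    obtain ⟨ha, rfl⟩ := h
    refine ⟨fun y hy => ?_, fun x hx => ⟨_, φ.monotone (a := ⟨x, hx.trans ha⟩) hx, .rel _ _ ⟨_, rfl⟩⟩⟩
    have hyτ : y ≤ τ := hy.trans (φ ⟨a, ha⟩).2
    exact ⟨(φ.symm ⟨y, hyτ⟩).1, (φ.symm_apply_le (x := ⟨a, ha⟩)).2 hy,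
      .rel _ _ ⟨(φ.symm ⟨y, hyτ⟩).2, by simp⟩⟩
  | refl a => exact ⟨fun y hy => ⟨y, hy, .refl _⟩, fun y hy => ⟨y, hy, .refl _⟩⟩
  | symm a b _ ih =>
    exact ⟨fun y hy => (ih.2 y hy).imp fun _ h => ⟨h.1, .symm _ _ h.2⟩,
      fun y hy => (ih.1 y hy).imp fun _ h => ⟨h.1, .symm _ _ h.2⟩⟩
  | trans a b c _ _ ih1 ih2 =>
    refine ⟨fun z hz => ?_, fun x hx => ?_⟩
    · obtain ⟨y, hy, hyz⟩ := ih2.1 z hz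
      obtain ⟨x, hx, hxy⟩ := ih1.1 y hy
      exact ⟨x, hx, .trans _ _ _ hxy hyz⟩
    · obtain ⟨y, hy, hyz⟩ := ih1.2 x hx
      obtain ⟨x, hx, hxy⟩ := ih2.2 y hy
      exact ⟨x, hx, .trans _ _ _ hyz hxy⟩

theorem eq_or_le_of_eqvGen {a b : P.Cell} (h : EqvGen (Identified φ) a b) :
    a = b ∨ (a ≤ σ ∨ a ≤ τ) ∧ (b ≤ σ ∨ b ≤ τ) := by
  induction h with
  | rel a b h => obtain ⟨ha, rfl⟩ := h; exact .inr ⟨.inl ha, .inr (φ ⟨a, ha⟩).2⟩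
  | refl => exact .inl rfl
  | symm _ _ _ ih => exact ih.imp Eq.symm And.symm
  | trans _ _ _ _ _ ih1 ih2 =>
    rcases ih1 with rfl | ih1
    · exact ih2
    · rcases ih2 with rfl | ih2
      · exact .inr ih1
      · exact .inr ⟨ih1.1, ih2.2⟩

end Identified

section Quotient

variable {P Q : SimplicialCW} {σ τ : P.Cell} {φ : Set.Iic σ ≃o Set.Iic τ} {q : P.Cell → Q.Cell}

/-- In a quotient that is again a simplicial regular CW complex, no closed cell is identified with a
smaller one: a strictly monotone map from a Boolean lattice onto another one is an isomorphism. -/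
theorem quotient_isSimplex (hsurj : q.Surjective)
    (hq : ∀ x y, q x = q y ↔ EqvGen (Identified φ) x y)
    (hle : ∀ x y, q x ≤ q y ↔ ∃ x' y', q x' = q x ∧ q y' = q y ∧ x' ≤ y') {m : ℕ} {y : P.Cell}
    (hy : IsSimplex m y) : IsSimplex m (q y) := by
  have hmono : Monotone q := fun x y h => (hle x y).2 ⟨x, y, rfl, rfl, h⟩
  have hstrict : StrictMono q := fun x y h => lt_of_le_of_ne (hmono h.le) fun heq =>
    (card_Iic_lt h).ne (card_Iic_eq_of_eqvGen ((hq x y).1 heq))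
  obtain ⟨m', hm'⟩ := Q.simplicial (q y)
  have h1 : m ≤ m' := by
    obtain ⟨e⟩ := hy
    obtain ⟨e'⟩ := hm'
    refine strictMono_card_le (fun S => e' ⟨q (e.symm S).1, hmono (e.symm S).2⟩) fun S T h => ?_
    exact e'.strictMono (hstrict (e.symm.strictMono h))
  have h2 : m' ≤ m := by
    have hle' : Nat.card (Set.Iic (q y)) ≤ Nat.card (Set.Iic y) := by
      refine Nat.card_le_card_of_surjective
        (fun x : Set.Iic y => (⟨q x, hmono x.2⟩ : Set.Iic (q y))) fun z => ?_
      obtain ⟨z, hz⟩ := z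
      obtain ⟨x, rfl⟩ := hsurj z
      obtain ⟨x', y', hx', hy', hxy⟩ := (hle x y).1 hz
      obtain ⟨x'', hx'', hxx⟩ := (exists_le_of_eqvGen ((hq y y').1 hy'.symm)).1 x' hxy
      exact ⟨⟨x'', hx''⟩, Subtype.ext (((hq _ _).2 hxx).trans hx')⟩
    rw [hm'.card_Iic, hy.card_Iic] at hle'
    exact (Nat.pow_le_pow_iff_right (by norm_num)).1 hle'
  rwa [le_antisymm h1 h2]

end Quotient

theorem IsPseudomanifold.exists_le {d : ℕ} {P : SimplicialCW} (h : P.IsPseudomanifold d) (x : P.Cell) :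
    ∃ s, IsSimplex (d + 1) s ∧ x ≤ s := by
  obtain ⟨s, hxs, hs⟩ := (Set.toFinite (Set.univ : Set P.Cell)).exists_le_maximal (Set.mem_univ x)
  exact ⟨s, h.1 s fun y hy => hs.2 (Set.mem_univ y) hy, hxs⟩

/-- Identifying `σ` and `τ` creates one interior cell. Its two `d`-cells are connected around the common
face `F` of `σ` and `τ`, since the star of `F` was connected before. -/
theorem IsConstructible.identifiesCells {d n : ℕ} {P Q : SimplicialCW} {E : Set P.Cell}
    (h : IsConstructible d n P E) (hP : P.IsPseudomanifold d) (hPQ : P.IdentifiesCells d Q) :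
    ∃ E', IsConstructible d n Q E' := by
  obtain ⟨σ, τ, F, φ, q, hσ, hτ, hστ, hF, hFσ, hFτ, -, hsurj, hq', hle⟩ := hPQ
  have hq : ∀ x y, q x = q y ↔ EqvGen (Identified φ) x y := hq'
  clear hq'
  obtain ⟨sσ, hsσ, hσs, hσuniq⟩ := exists_cofacet hσ
  obtain ⟨sτ, hsτ, hτs, hτuniq⟩ := exists_cofacet hτ
  have hmono : Monotone q := fun x y h => (hle x y).2 ⟨x, y, rfl, rfl, h⟩
  have hdim : ∀ k x, IsSimplex k x → IsSimplex k (q x) := fun k x hx =>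
    quotient_isSimplex hsurj hq hle hx
  have hdim' : ∀ k x, IsSimplex k (q x) → IsSimplex k x := fun k x hx => by
    obtain ⟨m, hm⟩ := P.simplicial x
    rwa [hx.dim_unique (hdim m x hm)]
  have hlift : ∀ x y, x ≤ q y → ∃ x' ≤ y, q x' = x := by
    intro x y hxy
    obtain ⟨x, rfl⟩ := hsurj x
    obtain ⟨x', y', hx', hy', hxy'⟩ := (hle x y).1 hxy
    obtain ⟨x'', hx'', hxx⟩ := (exists_le_of_eqvGen ((hq y y').1 hy'.symm)).1 x' hxy'
    exact ⟨x'', hx'', ((hq _ _).2 hxx).trans hx'⟩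
  have hqστ : q σ = q τ := (hq _ _).2 (.rel _ _ ⟨le_rfl, congrArg Subtype.val (map_top φ)⟩)
  have hinj : ∀ a b, IsSimplex (d + 1) a → IsSimplex (d + 1) b → q a = q b → a = b := by
    intro a b ha hb hab
    rcases eq_or_le_of_eqvGen ((hq a b).1 hab) with hab | ⟨hab | hab, -⟩
    · exact hab
    · exact absurd hab (ha.not_le hσ.1)
    · exact absurd hab (ha.not_le hτ.1)
  have hinj' : ∀ a b, IsSimplex d a → IsSimplex d b → q a = q b →
      a = b ∨ (a = σ ∨ a = τ) ∧ (b = σ ∨ b = τ) := fun a b ha hb hab =>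
    (eq_or_le_of_eqvGen ((hq a b).1 hab)).imp_right fun hh =>
      ⟨hh.1.imp (ha.eq_of_le hσ.1) (ha.eq_of_le hτ.1), hh.2.imp (hb.eq_of_le hσ.1) (hb.eq_of_le hτ.1)⟩
  have hmap : ∀ {A : Set P.Cell} {B : Set Q.Cell} {x : P.Cell} {y : Q.Cell} {a b : P.Cell},
      (∀ m s t, IsDoor d m s t → m ∈ A → q m ∈ B) → y ≤ q x →
      ReflTransGen (Cross d A x) a b → ReflTransGen (Cross d B y) (q a) (q b) :=
    fun hAB hxy hab => reach_map hmono hdim hinj hAB hxy hab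
  have hdoor : ∀ {m s t}, IsDoor d m s t → IsDoor d (q m) (q s) (q t) := fun hm =>
    ⟨hdim _ _ hm.1, hdim _ _ hm.2.1, hdim _ _ hm.2.2.1,
      fun hh => hm.2.2.2.1 (hinj _ _ hm.2.1 hm.2.2.1 hh), hmono hm.2.2.2.2.1, hmono hm.2.2.2.2.2⟩
  refine ⟨q '' E, fun x' s' t' hs' ht' hxs hxt => ?_, fun s' t' hs' ht' => ?_,
    (Set.ncard_image_le (Set.toFinite E)).trans h.card_tree, fun A hA hcl m s' t' hm => ?_⟩
  · -- The preimages of `x'` are linked by the identification, so that one may have to pass from the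
    -- star of a face of `σ` to the star of a face of `τ` through the new interior cell.
    have key : ∀ x y, EqvGen (Identified φ) x y → ∀ s t, IsSimplex (d + 1) s → IsSimplex (d + 1) t →
        x ≤ s → y ≤ t → ReflTransGen (Cross d Set.univ (q x)) (q s) (q t) := by
      intro x y hxy
      induction hxy with
      | rel x y hxy =>
        intro s t hs ht hxs hyt
        have hqxy : q x = q y := (hq x y).2 (.rel _ _ hxy)
        obtain ⟨hxσ, rfl⟩ := hxy
        have hyτ : (φ ⟨x, hxσ⟩).1 ≤ τ := (φ ⟨x, hxσ⟩).2
        have h1 := hmap (B := Set.univ) (y := q x) (by simp) le_rfl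
          (h.star x s sσ hs hsσ hxs (hxσ.trans hσs))
        have h2 := hmap (B := Set.univ) (y := q x) (by simp) hqxy.le
          (h.star _ sτ t hsτ ht (hyτ.trans hτs) hyt)
        by_cases hne : q sσ = q sτ
        · rw [hne] at h1; exact h1.trans h2
        · exact (h1.tail ⟨hdim _ _ hsσ, hdim _ _ hsτ, hne, q σ, trivial, hdim _ _ hσ.1, hmono hxσ,
            hmono hσs, hqστ ▸ hmono hτs⟩).trans h2
      | refl x => exact fun s t hs ht hxs hyt => hmap (by simp) le_rfl (h.star x s t hs ht hxs hyt)
      | symm x y hxy ih =>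
        intro s t hs ht hxs hyt
        rw [← (hq x y).2 hxy]
        exact reach_symm (ih t s ht hs hyt hxs)
      | trans x y z hxy _ ih1 ih2 =>
        intro s t hs ht hxs hyt
        obtain ⟨r, hr, hyr⟩ := hP.exists_le y
        have := ih2 r t hr ht hyr hyt
        rw [← (hq x y).2 hxy] at this
        exact (ih1 s r hs hr hxs hyr).trans this
    obtain ⟨s, rfl⟩ := hsurj s'
    obtain ⟨t, rfl⟩ := hsurj t'
    obtain ⟨x, hx, rfl⟩ := hlift _ _ hxs
    obtain ⟨y, hy, hxy⟩ := hlift _ _ hxt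
    exact key x y ((hq x y).1 hxy.symm) s t (hdim' _ _ hs') (hdim' _ _ ht') hx hy
  · obtain ⟨s, rfl⟩ := hsurj s'
    obtain ⟨t, rfl⟩ := hsurj t'
    exact hmap (fun m _ _ _ hm => ⟨m, hm, rfl⟩) bot_le
      (h.connected s t (hdim' _ _ hs') (hdim' _ _ ht'))
  · have hold : ∀ m s t, IsDoor d m s t → q m ∈ A := by
      refine h.closure (q ⁻¹' A) (fun m hm => hA ⟨m, hm, rfl⟩) fun m F s t hm hF hFm hst => ?_
      exact hcl (q m) (q F) (q s) (q t) (hdoor hm) (hdim _ _ hF) (hmono hFm)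
        (hmap (fun _ _ _ _ h => h) le_rfl hst)
    obtain ⟨hmd, hs', ht', hne, hms, hmt⟩ := id hm
    obtain ⟨s, rfl⟩ := hsurj s'
    obtain ⟨t, rfl⟩ := hsurj t'
    obtain ⟨m₁, hm₁, rfl⟩ := hlift _ _ hms
    obtain ⟨m₂, hm₂, hqm⟩ := hlift _ _ hmt
    have hs := hdim' _ _ hs'
    have ht := hdim' _ _ ht'
    have hst : s ≠ t := fun hh => hne (by rw [hh])
    have hm₁d := hdim' _ _ hmd
    have hm₂d := hdim' _ _ (hqm ▸ hmd)
    -- The new interior cell joins `d`-cells that are already connected around `F`.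
    have hnew : F ≤ m₁ → F ≤ m₂ → q m₁ ∈ A := by
      intro hF₁ hF₂
      exact hcl (q m₁) (q F) (q s) (q t) hm (hdim _ _ hF) (hmono hF₁)
        (hmap (fun m s t hm _ => hold m s t hm) le_rfl
          (h.star F s t hs ht (hF₁.trans hm₁) (hF₂.trans hm₂)))
    rcases hinj' m₁ m₂ hm₁d hm₂d hqm.symm with rfl | ⟨rfl | rfl, rfl | rfl⟩
    · exact hold m₁ s t ⟨hm₁d, hs, ht, hst, hm₁, hm₂⟩
    · exact hnew hFσ hFσ
    · exact hnew hFσ hFτ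
    · exact hnew hFτ hFσ
    · exact hnew hFτ hFτ

end SimplicialCW

/-! ### From locally constructible complexes to families of facets -/

namespace AbstractSimplicialComplex

open Relation

/-- Each of the `N - 1` attachments adds one cell to the tree, and the identifications add none. -/
theorem exists_isConstructible_of_sequence {d N k : ℕ} (hN : 1 ≤ N) {T : ℕ → SimplicialCW}
    (hT : ∀ i, 1 ≤ i → i ≤ k → (T i).IsPseudomanifold d)
    (h1 : Nonempty ((T 1).Cell ≃o Finset (Fin (d + 1))))
    (hglue : ∀ i, 1 ≤ i → i < N → (T i).GluesSimplex d (T (i + 1)))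
    (hident : ∀ i, N ≤ i → i < k → (T i).IdentifiesCells d (T (i + 1))) :
    ∀ i, 1 ≤ i → (i ≤ N ∨ i ≤ k) → ∃ E, SimplicialCW.IsConstructible d (min i N - 1) (T i) E := by
  intro i hi
  induction i, hi using Nat.le_induction with
  | base =>
    intro _
    obtain ⟨e⟩ := h1
    refine ⟨∅, ?_⟩
    rw [show min 1 N - 1 = 0 by omega]
    exact SimplicialCW.isConstructible_simplex e
  | succ i hi ih =>
    intro hik
    obtain ⟨E, hE⟩ := ih (by omega)
    rcases lt_or_ge i N with hlt | hge
    · rw [show min (i + 1) N - 1 = (min i N - 1) + 1 by omega]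
      exact hE.gluesSimplex (hglue i hi hlt)
    · rw [show min (i + 1) N - 1 = min i N - 1 by omega]
      exact hE.identifiesCells (hT i hi (by omega)) (hident i hge (by omega))

theorem card_eq_of_isSimplex {V : Type*} {k : ℕ} {s : Finset V} (h : IsSimplex k s) : s.card = k := by
  classical
  have h1 : Nat.card (Set.Iic s) = 2 ^ s.card := by
    rw [Nat.card_coe_set_eq, ← Finset.card_powerset, ← Set.ncard_coe_finset]
    congr 1
    ext t
    simp
  exact Nat.pow_right_injective le_rfl (h1.symm.trans h.card_Iic)

/-- The face poset of a simplicial complex, embedded into the subsets of the vertex set. -/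
theorem exists_faceEmbedding {V P : Type*} [PartialOrder P] (K : AbstractSimplicialComplex V)
    (e : P ≃o WithBot {s : Finset V // s ∈ K.faces}) :
    ∃ f : P ↪o Finset V, ∀ s, s ∈ Set.range f ↔ s = ∅ ∨ s ∈ K.faces := by
  let g : WithBot {s : Finset V // s ∈ K.faces} ↪o Finset V :=
    OrderEmbedding.ofMapLEIff (fun x => x.recBotCoe ∅ (·.1)) fun x y => by
      induction x with
      | bot => simp
      | coe x =>
        induction y with
        | bot =>
          have : x.1.Nonempty := (K.isRelLowerSet_faces x.2).1
          simp [this.ne_empty]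
        | coe y => simp [WithBot.coe_le_coe]
  refine ⟨e.toOrderEmbedding.trans g, fun s => ⟨?_, ?_⟩⟩
  · rintro ⟨x, rfl⟩
    change g (e x) = ∅ ∨ g (e x) ∈ K.faces
    induction e x with
    | bot => exact .inl rfl
    | coe y => exact .inr y.2
  · rintro (rfl | hs)
    · exact ⟨e.symm ⊥, by change g (e (e.symm ⊥)) = ∅; rw [e.apply_symm_apply]; rfl⟩
    · exact ⟨e.symm (⟨s, hs⟩ : {s : Finset V // s ∈ K.faces}),
        by change g (e (e.symm _)) = s; rw [e.apply_symm_apply]; rfl⟩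

variable {n d : ℕ} {K : AbstractSimplicialComplex (Fin n)}

theorem exists_facet_of_face {s : Finset (Fin n)} (hs : s ∈ K.faces) : ∃ t ∈ K.facets, s ⊆ t := by
  obtain ⟨t, hst, ht⟩ := (Set.toFinite K.faces).exists_le_maximal hs
  exact ⟨t, ht, hst⟩

theorem mem_faces_iff {s : Finset (Fin n)} :
    s ∈ K.faces ↔ s.Nonempty ∧ ∃ t ∈ K.facets, s ⊆ t :=
  ⟨fun hs => ⟨(K.isRelLowerSet_faces hs).1, exists_facet_of_face hs⟩,
    fun ⟨hs, _, ht, hst⟩ => (K.isRelLowerSet_faces ht.1).2 hst hs⟩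

theorem exists_facet_of_vertex (v : Fin n) : ∃ t ∈ K.facets, v ∈ t := by
  obtain ⟨t, ht, hvt⟩ := exists_facet_of_face (K.singleton_mem v)
  exact ⟨t, ht, hvt (Finset.mem_singleton_self v)⟩

/-- The facets of a complex on a finite vertex set. -/
noncomputable def facetFinset (K : AbstractSimplicialComplex (Fin n)) : Finset (Finset (Fin n)) :=
  (Set.toFinite K.facets).toFinset

theorem mem_facetFinset {s : Finset (Fin n)} : s ∈ K.facetFinset ↔ s ∈ K.facets := by
  simp [facetFinset]

theorem card_facetFinset : K.facetFinset.card = K.facets.ncard :=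
  (Set.ncard_eq_toFinset_card _ _).symm

theorem mem_facets_of_card (hK : K.IsPure d) {s : Finset (Fin n)} (hs : s ∈ K.faces)
    (hcard : s.card = d + 1) : s ∈ K.facets := by
  obtain ⟨t, ht, hst⟩ := exists_facet_of_face hs
  rwa [Finset.eq_of_subset_of_card_le hst (by rw [hcard, hK.2 t ht])]

/-- The last complex of a local construction is the face poset of `K`, so that its properties are
properties of the family of facets. -/
theorem IsLC.exists_isConstructible (hd : 2 ≤ d) (hK : K.IsLC d) (hN : 1 ≤ K.facets.ncard) :
    ∃ E, FacetFamily.IsConstructible d K.facetFinset E := by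
  obtain ⟨hpure, k, T, hNk, hT, h1, hglue, hident, ⟨e⟩⟩ := hK
  obtain ⟨E, hE⟩ := exists_isConstructible_of_sequence hN hT h1 hglue hident k (by omega) (by omega)
  rw [min_eq_right hNk] at hE
  have hP := hT k (by omega) le_rfl
  obtain ⟨f, hf⟩ := K.exists_faceEmbedding e
  have hlower : IsLowerSet (Set.range f) := by
    intro s t hts hs
    rw [hf] at hs ⊢
    rcases hs with rfl | hs
    · exact .inl (Finset.subset_empty.1 hts)
    · rcases t.eq_empty_or_nonempty with ht | ht
      · exact .inl ht
      · exact .inr ((K.isRelLowerSet_faces hs).2 hts ht)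
  have hcard : ∀ {m x}, IsSimplex m x → (f x).card = m := fun hx =>
    card_eq_of_isSimplex ((isSimplex_iff_of_isLowerSet hlower).2 hx)
  have hdim : ∀ x, IsSimplex (f x).card x := fun x => by
    obtain ⟨m, hm⟩ := (T k).simplicial x
    rwa [hcard hm]
  have hcell : ∀ s, s ∈ K.facetFinset ↔ ∃ x, IsSimplex (d + 1) x ∧ f x = s := by
    intro s
    rw [mem_facetFinset]
    constructor
    · intro hs
      obtain ⟨x, rfl⟩ := (hf s).2 (.inr hs.1)
      exact ⟨x, hpure.2 _ hs ▸ hdim x, rfl⟩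
    · rintro ⟨x, hx, rfl⟩
      refine mem_facets_of_card hpure (((hf _).1 ⟨x, rfl⟩).resolve_left fun h0 => ?_) (hcard hx)
      have := hcard hx
      rw [h0] at this
      simp at this
  have hbelow : ∀ {m x}, m ⊆ f x → ∃ y ≤ x, f y = m := by
    intro m x hm
    obtain ⟨y, rfl⟩ := hlower hm ⟨x, rfl⟩
    exact ⟨y, f.le_iff_le.1 hm, rfl⟩
  have hdoor : ∀ {m s t}, SimplicialCW.IsDoor d m s t ↔
      FacetFamily.IsDoor d K.facetFinset (f m) (f s) (f t) := by
    intro m s t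
    have hiff : ∀ x, IsSimplex (d + 1) x ↔ f x ∈ K.facetFinset := fun x => by
      rw [hcell]
      exact ⟨fun hx => ⟨x, hx, rfl⟩, fun ⟨y, hy, hyx⟩ => f.injective hyx ▸ hy⟩
    have hiff' : IsSimplex d m ↔ (f m).card = d := ⟨hcard, fun h => h ▸ hdim m⟩
    rw [SimplicialCW.IsDoor, FacetFamily.IsDoor, hiff', hiff, hiff, ne_eq, ne_eq, f.injective.eq_iff,
      ← f.le_iff_le, ← f.le_iff_le]
  have hreach : ∀ {A : Set (T k).Cell} {B : Set (Finset (Fin n))} {x : (T k).Cell}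
      {y : Finset (Fin n)} {a b}, f '' A ⊆ B → y ⊆ f x → ReflTransGen (SimplicialCW.Cross d A x) a b →
      ReflTransGen (FacetFamily.Cross d K.facetFinset B y) (f a) (f b) := by
    intro A B x y a b hAB hyx hab
    refine ReflTransGen.lift f (fun a b hab => ?_) _ _ hab
    obtain ⟨ha, hb, hab, m, hm, hmd, hF, hma, hmb⟩ := hab
    have h := hdoor.1 ⟨hmd, ha, hb, hab, hma, hmb⟩
    exact ⟨h.2.1, h.2.2.1, h.2.2.2.1, f m, hAB ⟨m, hm, rfl⟩, h.1, hyx.trans (f.monotone hF), h.2.2.2.2⟩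
  classical
  refine ⟨(Set.toFinite (f '' E)).toFinset, fun s hs => hpure.2 s (mem_facetFinset.1 hs), ?_, ?_, ?_,
    ?_, ?_⟩
  · intro m a b c hm ha hb hc hma hmb hmc hba hca
    by_contra hbc
    obtain ⟨a, ha', rfl⟩ := (hcell a).1 ha
    obtain ⟨b, hb', rfl⟩ := (hcell b).1 hb
    obtain ⟨c, hc', rfl⟩ := (hcell c).1 hc
    obtain ⟨m, hma', rfl⟩ := hbelow hma
    have hsub : ({a, b, c} : Finset (T k).Cell) ⊆ (Set.toFinite ((T k).cofacets d m)).toFinset := by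
      intro u hu
      rw [Set.Finite.mem_toFinset]
      simp only [Finset.mem_insert, Finset.mem_singleton] at hu
      rcases hu with rfl | rfl | rfl
      · exact ⟨ha', hma'⟩
      · exact ⟨hb', f.le_iff_le.1 hmb⟩
      · exact ⟨hc', f.le_iff_le.1 hmc⟩
    have h3 : ({a, b, c} : Finset (T k).Cell).card = 3 :=
      Finset.card_eq_three.2 ⟨a, b, c, fun hh => hba (by rw [hh]), fun hh => hca (by rw [hh]),
        fun hh => hbc (by rw [hh]), rfl⟩
    have h2 := hP.2 m (hm ▸ hdim m)
    rw [Set.ncard_eq_toFinset_card _ (Set.toFinite _)] at h2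
    have := Finset.card_le_card hsub
    omega
  · intro v s hs t ht hvs hvt
    obtain ⟨s, hs', rfl⟩ := (hcell s).1 hs
    obtain ⟨t, ht', rfl⟩ := (hcell t).1 ht
    obtain ⟨x, hxs, hx⟩ := hbelow (Finset.singleton_subset_iff.2 hvs)
    refine hreach (Set.subset_univ _) hx.ge (hE.star x s t hs' ht' hxs (f.le_iff_le.1 ?_))
    rw [hx]
    exact Finset.singleton_subset_iff.2 hvt
  · intro s hs t ht
    obtain ⟨s, hs', rfl⟩ := (hcell s).1 hs
    obtain ⟨t, ht', rfl⟩ := (hcell t).1 ht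
    exact hreach (by simp) (Finset.empty_subset _) (hE.connected s t hs' ht')
  · rw [← Set.ncard_eq_toFinset_card, card_facetFinset]
    have := Set.ncard_image_le (f := f) (Set.toFinite E)
    have := hE.card_tree
    omega
  · intro A hEA hA m s t hm
    obtain ⟨s, hs', rfl⟩ := (hcell s).1 hm.2.1
    obtain ⟨t, ht', rfl⟩ := (hcell t).1 hm.2.2.1
    obtain ⟨m, hms, rfl⟩ := hbelow hm.2.2.2.2.1
    refine hE.closure (f ⁻¹' A) (fun x hx => hEA (by simpa using hx)) ?_ m s t (hdoor.2 hm)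
    intro m F s t hm hF hFm hst
    have hFc := hcard hF
    exact hA (f m) (f F) (f s) (f t) (hdoor.1 hm) (by omega) (f.monotone hFm)
      (hreach (Set.image_preimage_subset _ _) subset_rfl hst)

end AbstractSimplicialComplex

/-! ### Counting combinatorial types -/

open FacetFamily in
theorem combinatorialEquivalence_of_gluing_eq {d N : ℕ} {K L : FiniteComplex}
    {E : Finset (Finset (Fin K.1))} {E' : Finset (Finset (Fin L.1))}
    {ℓ : Fin N → Fin (d + 1) → Fin K.1} {ℓ' : Fin N → Fin (d + 1) → Fin L.1}
    (hK : IsConstructible d K.2.facetFinset E) (hL : IsConstructible d L.2.facetFinset E')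
    (hℓ : IsFullLabelling K.2.facetFinset ℓ) (hℓ' : IsFullLabelling L.2.facetFinset ℓ')
    (hG : gluing ℓ (doors d K.2.facetFinset) = gluing ℓ' (doors d L.2.facetFinset)) :
    combinatorialEquivalence K L := by
  have hmem : ∀ {n} (K : AbstractSimplicialComplex (Fin n)) v, ∃ f ∈ K.facetFinset, v ∈ f := by
    intro n K v
    obtain ⟨t, ht, hv⟩ := AbstractSimplicialComplex.exists_facet_of_vertex (K := K) v
    exact ⟨t, AbstractSimplicialComplex.mem_facetFinset.2 ht, hv⟩
  obtain ⟨e, he⟩ := hK.exists_equiv hL hℓ hℓ' (hmem K.2) (hmem L.2) hG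
  refine ⟨e, fun s => ?_⟩
  rw [AbstractSimplicialComplex.mem_faces_iff, AbstractSimplicialComplex.mem_faces_iff,
    Finset.map_nonempty]
  refine and_congr_right fun _ => ⟨?_, ?_⟩
  · rintro ⟨t, ht, hst⟩
    obtain ⟨i, rfl⟩ := hℓ.exists_facet t (AbstractSimplicialComplex.mem_facetFinset.2 ht)
    refine ⟨facet (ℓ' i), AbstractSimplicialComplex.mem_facetFinset.1 (hℓ'.facet_mem i), ?_⟩
    rw [← he i]
    exact Finset.map_subset_map.2 hst
  · rintro ⟨t, ht, hst⟩
    obtain ⟨i, rfl⟩ := hℓ'.exists_facet t (AbstractSimplicialComplex.mem_facetFinset.2 ht)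
    refine ⟨facet (ℓ i), AbstractSimplicialComplex.mem_facetFinset.1 (hℓ.facet_mem i), ?_⟩
    rw [← he i] at hst
    exact Finset.map_subset_map.1 hst

/-- There are at most as many combinatorial types of locally constructible complexes as codes. -/
theorem combinatorialTypes_finite_and_ncard_le {d N : ℕ} (hd : 2 ≤ d) (hN : 1 ≤ N)
    {p : FiniteComplex → Prop} (hp : ∀ K, p K → K.2.IsLC d ∧ K.2.facets.ncard = N) :
    (combinatorialTypes p).Finite ∧
      (combinatorialTypes p).ncard ≤ (FacetFamily.codePairs d N).card := by
  have hcode : ∀ c : combinatorialTypes p, ∃ b : FacetFamily.codePairs d N, ∃ K : FiniteComplex,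
      Quotient.mk combinatorialEquivalence K = c ∧ ∃ E,
      FacetFamily.IsConstructible d K.2.facetFinset E ∧ ∃ ℓ : Fin N → Fin (d + 1) → Fin K.1,
      FacetFamily.IsFullLabelling K.2.facetFinset ℓ ∧
        FacetFamily.decode d N b = FacetFamily.gluing ℓ (FacetFamily.doors d K.2.facetFinset) := by
    rintro ⟨c, K, hK, rfl⟩
    obtain ⟨hLC, hcard⟩ := hp K hK
    obtain ⟨E, hE⟩ := hLC.exists_isConstructible hd (hcard ▸ hN)
    obtain ⟨b, hb, ℓ, hℓ, hG⟩ := hE.exists_code hd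
      (AbstractSimplicialComplex.card_facetFinset.trans hcard)
    exact ⟨⟨b, hb⟩, K, rfl, E, hE, ℓ, hℓ, hG⟩
  choose b hb using hcode
  have hinj : b.Injective := by
    intro c c' hcc
    obtain ⟨K, hK, E, hE, ℓ, hℓ, hG⟩ := hb c
    obtain ⟨L, hL, E', hE', ℓ', hℓ', hG'⟩ := hb c'
    refine Subtype.ext ?_
    rw [← hK, ← hL]
    refine Quotient.sound (combinatorialEquivalence_of_gluing_eq hE hE' hℓ hℓ' ?_)
    rw [← hG, ← hG', hcc]
  have hfin : Finite (combinatorialTypes p) := Finite.of_injective b hinj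
  refine ⟨hfin, ?_⟩
  rw [← Nat.card_coe_set_eq]
  refine (Nat.card_le_card_of_injective b hinj).trans (le_of_eq ?_)
  simp

theorem mainTheorem3 (d : ℕ) (hd : 2 ≤ d) :
    ∃ N₀ : ℕ, ∀ N : ℕ, N₀ ≤ N →
      ((lcSphereTypes d N).Finite ∧
        ((lcSphereTypes d N).ncard : ℝ) ≤
          ((d : ℝ) * ((d : ℝ) / ((d : ℝ) - 1)) ^ (d - 1) *
            (2 : ℝ) ^ ((2 * (d : ℝ) ^ 2 - (d : ℝ)) / 3)) ^ N ∧
        (lcSphereTypes d N).ncard < 2 ^ (d ^ 2 * N)) ∧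
      ((lcBallTypes d N).Finite ∧
        ((lcBallTypes d N).ncard : ℝ) ≤
          ((d : ℝ) * ((d : ℝ) / ((d : ℝ) - 1)) ^ (d - 1) *
            (2 : ℝ) ^ ((2 * (d : ℝ) ^ 2 - (d : ℝ)) / 3)) ^ N ∧
        (lcBallTypes d N).ncard < 2 ^ (d ^ 2 * N)) := by
  obtain ⟨N₀, hN₀, hlt⟩ := LCEstimate.eventually_codes_lt d hd
  have key : ∀ N, N₀ ≤ N → ∀ p : FiniteComplex → Prop,
      (∀ K, p K → K.2.IsLC d ∧ K.2.facets.ncard = N) →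
      (combinatorialTypes p).Finite ∧ ((combinatorialTypes p).ncard : ℝ) ≤ LCEstimate.rate d ^ N ∧
        (combinatorialTypes p).ncard < 2 ^ (d ^ 2 * N) := by
    intro N hN p hp
    obtain ⟨hfin, hcard⟩ := combinatorialTypes_finite_and_ncard_le hd (hN₀.trans hN) hp
    have h1 : ((combinatorialTypes p).ncard : ℝ) < LCEstimate.rate d ^ N := by
      refine lt_of_le_of_lt (Nat.cast_le.2 hcard) ?_
      rw [FacetFamily.codePairs, Finset.card_product]
      exact hlt N hN
    refine ⟨hfin, h1.le, ?_⟩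
    have h2 : LCEstimate.rate d ^ N ≤ 2 ^ (d ^ 2 * N) := by
      rw [pow_mul]
      exact pow_le_pow_left₀ (LCEstimate.rate_nonneg d hd) (LCEstimate.rate_le d hd) N
    exact_mod_cast h1.trans_le h2
  exact ⟨N₀, fun N hN => ⟨key N hN _ fun K hK => hK.2, key N hN _ fun K hK => hK.2⟩⟩
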